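/- Throughout, $e=\exp(1)$. Let $G$ be a finite multigraph (loops and parallel edges allowed) with edge set $E$, and let $M=M^*(G)$ be its cographic matroid, the dual of the cycle matroid $M(G)$ whose independent sets are the forests of $G$. **Model (zero information).** An adversary fixes weights $w:E\to[0,\infty)$. The elements of $E$ arrive in a uniformly random order. An online algorithm knows $G$, may use random bits independent of the order, sees the relative order of the weights of the elements that have arrived (ties are broken by an independent uniformly random ordering of $E$), and irrevocably accepts or rejects each element when it arrives. It is *$c$-competitive for $M$* if for every such $w$ the set $\mathrm{ALG}$ of accepted elements is always independent in $M$ and $c\,\mathbb E[w(\mathrm{ALG})]\ge \max\{w(I): I \text{ independent in } M\}$. **Algorithm for arbitrary $G$.** Two non-loop elements of a matroid are *parallel* if they are equal or form a circuit; elements are *in series* if they are parallel in the dual matroid. Remove all bridges of $G$, and let $C$ range over the connected components of the remaining graph. For each $C$ choose a set $R_C$ containing exactly one edge of each serial class of $M(C)$, let $C'$ be the graph obtained from $C$ by contracting all edges outside $R_C$, and choose three bases $B^C_1,B^C_2,B^C_3$ of the cographic matroid of $C'$ with $B^C_1\cup B^C_2\cup B^C_3=E(C')$. Independently for each $C$ draw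 $i_C\in\{1,2,3\}$ uniformly at random. Discard all bridges and all edges of $C$ whose parallel class in $M$ does not meet $B^C_{i_C}$. On each parallel class $P\subseteq E(C)$ of $M$ that meets $B^C_{i_C}$ run the secretary algorithm: the first $\lfloor |P|/e\rfloor$ elements of $P$ to arrive are only observed, and after that the first element of $P$ that is heavier than all elements of $P$ that arrived before it is accepted (if there is one), and no further element of $P$. **Algorithm for $3$-edge-connected $G$.** Choose three spanning trees $T_1,T_2,T_3$ of $G$ with $\bigcup_i (E\setminus T_i)=E$, draw $i\in\{1,2,3\}$ uniformly at random, and accept exactly the elements of $E\setminus T_i$. **Theorem.** 1. Sets $R_C$ as above exist. For every choice of them, each $C'$ is $3$-edge-connected and bases $B^C_1,B^C_2,B^C_3$ as above exist. For every choice of the $R_C$ and the $B^C_i$, the algorithm for arbitrary $G$ is $3e$-competitive for $M$. 2. If $G$ is $3$-edge-connected, then trees $T_1,T_2,T_3$ as above exist, and for every choice of them the algorithm for $3$-edge-connected graphs is $3$-competitive for $M$. Moreover, the algorithm for arbitrary $G$ is then $3$-competitive for $M$ as well, for every choice of the $R_C$ and the $B^C_i$. -/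

import Mathlib

open scoped Graph

/-! ### Connectivity, bridges, forests and contraction in multigraphs -/

namespace Graph

universe u v

variable {α : Type u} {β : Type v}

/-- `x` and `y` are joined by a walk of `G` all of whose edges lie in `F`. -/
def ReachVia (G : Graph α β) (F : Set β) : α → α → Prop :=
  Relation.ReflTransGen fun a b => ∃ e ∈ F, G.IsLink e a b

/-- A graph is connected if it has a vertex and any two of its vertices are joined by a walk. -/
def IsConnected (G : Graph α β) : Prop :=
  V(G).Nonempty ∧ ∀ x ∈ V(G), ∀ y ∈ V(G), G.ReachVia E(G) x y

/-- `G` is `k`-edge-connected: it stays connected after the deletion of fewer than `k` edges. -/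
def IsEdgeConnected (G : Graph α β) (k : ℕ) : Prop :=
  ∀ F ⊆ E(G), F.encard < k → (G.deleteEdges F).IsConnected

/-- The bridges of `G`: the edges whose deletion separates their two ends. -/
def bridges (G : Graph α β) : Set β :=
  {e | e ∈ E(G) ∧ ∀ x y, G.IsLink e x y → ¬ G.ReachVia (E(G) \ {e}) x y}

/-- A set of edges is a forest if it contains no cycle, i.e. the ends of an edge `e` of `F` are
never joined by a walk in `F \ {e}` (so a forest has no loops). -/
def IsForest (G : Graph α β) (F : Set β) : Prop :=
  F ⊆ E(G) ∧ ∀ e ∈ F, ∀ x y, G.IsLink e x y → ¬ G.ReachVia (F \ {e}) x y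

/-- A (the edge set of a) spanning tree: a forest joining any two vertices. -/
def IsSpanningTree (G : Graph α β) (T : Set β) : Prop :=
  G.IsForest T ∧ ∀ x ∈ V(G), ∀ y ∈ V(G), G.ReachVia T x y

/-- The graph `G / F`. Each vertex is replaced by the set of vertices that it is joined to by
edges of `F`, and the edges of `F` disappear; other edges inside such a set become loops. -/
def contractEdges (G : Graph α β) (F : Set β) : Graph (Set α) β :=
  (G.map fun x => {y | G.ReachVia F x y}).deleteEdges F

/-! ### The cycle matroid and the cographic matroid -/

theorem ReachVia.mono {G : Graph α β} {F F' : Set β} (h : F ⊆ F') {x y : α}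
    (hxy : G.ReachVia F x y) : G.ReachVia F' x y :=
  Relation.ReflTransGen.mono (fun _ _ h' => h'.imp fun _ he => ⟨h he.1, he.2⟩) x y hxy

theorem ReachVia.symm {G : Graph α β} {F : Set β} {x y : α}
    (hxy : G.ReachVia F x y) : G.ReachVia F y x := by
  induction hxy with
  | refl => exact .refl
  | tail _ h ih =>
    obtain ⟨e, he, hl⟩ := h
    exact Relation.ReflTransGen.head ⟨e, he, hl.symm⟩ ih

/-- The edges of `G` whose two ends are joined by a walk in `F`. -/
def edgeSpan (G : Graph α β) (F : Set β) : Set β :=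
  {e | ∃ x y, G.IsLink e x y ∧ G.ReachVia F x y}

theorem reachVia_of_mem_edgeSpan {G : Graph α β} {F : Set β} {e : β} {x y : α}
    (he : e ∈ G.edgeSpan F) (h : G.IsLink e x y) : G.ReachVia F x y := by
  obtain ⟨a, b, hl, hr⟩ := he
  obtain ⟨rfl, rfl⟩ | ⟨rfl, rfl⟩ := h.eq_and_eq_or_eq_and_eq hl
  · exact hr
  · exact hr.symm

theorem edgeSpan_mono {G : Graph α β} {F F' : Set β} (h : F ⊆ F') :
    G.edgeSpan F ⊆ G.edgeSpan F' :=
  fun _ ⟨x, y, hl, hr⟩ => ⟨x, y, hl, hr.mono h⟩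

theorem ReachVia.of_subset_edgeSpan {G : Graph α β} {F F' : Set β}
    (h : ∀ e ∈ F, e ∈ E(G) → e ∈ G.edgeSpan F') {x y : α} (hxy : G.ReachVia F x y) :
    G.ReachVia F' x y := by
  induction hxy with
  | refl => exact .refl
  | tail _ hs ih =>
    obtain ⟨e, he, hl⟩ := hs
    exact ih.trans (reachVia_of_mem_edgeSpan (h e he hl.edge_mem) hl)

theorem mem_edgeSpan_of_mem {G : Graph α β} {F : Set β} {e : β} (he : e ∈ F) (hE : e ∈ E(G)) :
    e ∈ G.edgeSpan F := by
  obtain ⟨x, y, hl⟩ := G.exists_isLink_of_mem_edgeSet hE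
  exact ⟨x, y, hl, .single ⟨e, he, hl⟩⟩

theorem edgeSpan_trans {G : Graph α β} {F F' : Set β} (h : F ⊆ G.edgeSpan F') :
    G.edgeSpan F ⊆ G.edgeSpan F' :=
  fun _ ⟨x, y, hl, hr⟩ => ⟨x, y, hl, hr.of_subset_edgeSpan fun _ hf _ => h hf⟩

theorem ReachVia.insert_cases {G : Graph α β} {F : Set β} {e : β} {a b x y : α}
    (he : G.IsLink e a b) (h : G.ReachVia (insert e F) x y) :
    G.ReachVia F x y ∨ (G.ReachVia F x a ∧ G.ReachVia F b y) ∨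
      (G.ReachVia F x b ∧ G.ReachVia F a y) := by
  induction h with
  | refl => exact .inl .refl
  | @tail c d _ hs ih =>
    obtain ⟨f, hf, hl⟩ := hs
    obtain rfl | hf := hf
    · obtain ⟨rfl, rfl⟩ | ⟨rfl, rfl⟩ := hl.eq_and_eq_or_eq_and_eq he
      · obtain h | h | h := ih
        · exact .inr (.inl ⟨h, .refl⟩)
        · exact .inr (.inl ⟨h.1, .refl⟩)
        · exact .inl h.1
      · obtain h | h | h := ih
        · exact .inr (.inr ⟨h, .refl⟩)
        · exact .inl h.1
        · exact .inr (.inr ⟨h.1, .refl⟩)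
    · have hs : G.ReachVia F c d := .single ⟨f, hf, hl⟩
      obtain h | h | h := ih
      · exact .inl (h.trans hs)
      · exact .inr (.inl ⟨h.1, h.2.trans hs⟩)
      · exact .inr (.inr ⟨h.1, h.2.trans hs⟩)

theorem edgeSpan_exchange {G : Graph α β} {F : Set β} {e f : β} (he : e ∈ E(G))
    (hf : f ∈ G.edgeSpan (insert e F)) (hfF : f ∉ G.edgeSpan F) :
    e ∈ G.edgeSpan (insert f F) := by
  obtain ⟨a, b, hab⟩ := G.exists_isLink_of_mem_edgeSet he
  obtain ⟨x, y, hxy, hr⟩ := hf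
  have hsub : F ⊆ insert f F := Set.subset_insert _ _
  have hf' : G.ReachVia (insert f F) x y := .single ⟨f, .inl rfl, hxy⟩
  refine ⟨a, b, hab, ?_⟩
  obtain h | h | h := hr.insert_cases hab
  · exact (hfF ⟨x, y, hxy, h⟩).elim
  · exact ((h.1.mono hsub).symm.trans hf').trans (h.2.mono hsub).symm
  · exact ((h.2.mono hsub).trans hf'.symm).trans (h.1.mono hsub)

theorem IsForest.notMem_edgeSpan {G : Graph α β} {F : Set β} (h : G.IsForest F) {e : β}
    (he : e ∈ F) : e ∉ G.edgeSpan (F \ {e}) :=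
  fun ⟨x, y, hl, hr⟩ => h.2 e he x y hl hr

theorem IsForest.subset {G : Graph α β} {F F' : Set β} (h : G.IsForest F') (hs : F ⊆ F') :
    G.IsForest F :=
  ⟨hs.trans h.1, fun e he x y hl hr =>
    h.2 e (hs he) x y hl (hr.mono (Set.sdiff_subset_sdiff_left hs))⟩

theorem IsForest.isForest_insert {G : Graph α β} {F : Set β} (h : G.IsForest F) {e : β} (hE : e ∈ E(G))
    (he : e ∉ G.edgeSpan F) : G.IsForest (insert e F) := by
  refine ⟨Set.insert_subset hE h.1, ?_⟩
  rintro f hf x y hl hr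
  by_cases hfe : f = e
  · subst hfe
    exact he ⟨x, y, hl, hr.mono (by intro g hg; exact hg.1.resolve_left hg.2)⟩
  have hfF : f ∈ F := hf.resolve_left hfe
  have hr' : G.ReachVia (insert e (F \ {f})) x y :=
    hr.mono (by rintro g ⟨rfl | hg, hgf⟩; exacts [.inl rfl, .inr ⟨hg, hgf⟩])
  have := edgeSpan_exchange hE ⟨x, y, hl, hr'⟩ (h.notMem_edgeSpan hfF)
  rw [Set.insert_sdiff_singleton, Set.insert_eq_of_mem hfF] at this
  exact he this

theorem IsForest.ncard_le [Finite β] {G : Graph α β} {J : Set β} (hJ : G.IsForest J) :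
    ∀ (n : ℕ) (I : Set β), I ⊆ E(G) → (I \ J).ncard = n → J ⊆ G.edgeSpan I →
      J.ncard ≤ I.ncard := by
  intro n
  induction n with
  | zero =>
    intro I hI h0 hJI
    have hIJ : I ⊆ J := by
      rw [Set.ncard_eq_zero (Set.toFinite _)] at h0
      exact Set.sdiff_eq_empty.1 h0
    refine Set.ncard_le_ncard (fun e he => ?_) (Set.toFinite _)
    by_contra heI
    exact hJ.notMem_edgeSpan he
      (edgeSpan_mono (Set.subset_sdiff_singleton hIJ heI) (hJI he))
  | succ n ih =>
    intro I hI hn hJI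
    obtain ⟨e, heI, heJ⟩ : (I \ J).Nonempty := by
      rw [← Set.ncard_pos (Set.toFinite _)]; omega
    have hcard : (I \ {e}).ncard + 1 = I.ncard :=
      Set.ncard_sdiff_singleton_add_one heI (Set.toFinite _)
    have hdiff : ((I \ {e}) \ J).ncard = n := by
      have h1 : (I \ {e}) \ J = (I \ J) \ {e} := by ext; simp; tauto
      have h2 := Set.ncard_sdiff_singleton_add_one (s := I \ J) ⟨heI, heJ⟩ (Set.toFinite _)
      rw [h1]; omega
    by_cases hsp : J ⊆ G.edgeSpan (I \ {e})
    · have := ih (I \ {e}) (Set.sdiff_subset.trans hI) hdiff hsp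
      omega
    · obtain ⟨f, hfJ, hf⟩ := Set.not_subset.1 hsp
      have hEI : insert e (I \ {e}) = I := by
        rw [Set.insert_sdiff_singleton, Set.insert_eq_of_mem heI]
      have hex : e ∈ G.edgeSpan (insert f (I \ {e})) :=
        edgeSpan_exchange (hI heI) (by rw [hEI]; exact hJI hfJ) hf
      have hI' : insert f (I \ {e}) ⊆ E(G) :=
        Set.insert_subset (hJ.1 hfJ) (Set.sdiff_subset.trans hI)
      have hfn : f ∉ I \ {e} := fun h => hf (mem_edgeSpan_of_mem h (hJ.1 hfJ))
      have hspan : I ⊆ G.edgeSpan (insert f (I \ {e})) := by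
        intro g hg
        by_cases hge : g = e
        · exact hge ▸ hex
        · exact mem_edgeSpan_of_mem (.inr ⟨hg, hge⟩) (hI hg)
      have hd : (insert f (I \ {e}) \ J).ncard = n := by
        rw [Set.insert_sdiff_of_mem _ hfJ, hdiff]
      have := ih _ hI' hd (hJI.trans (edgeSpan_trans hspan))
      rw [Set.ncard_insert_of_notMem hfn (Set.toFinite _)] at this
      omega

/-- The cycle (graphic) matroid of `G`: its independent sets are the forests of `G`. -/
def cycleMatroid [Finite β] (G : Graph α β) : Matroid β :=
  (IndepMatroid.ofFinite (E := E(G)) (Set.toFinite _) G.IsForest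
    ⟨Set.empty_subset _, fun _ h => h.elim⟩
    (fun _ _ hJ hIJ => hJ.subset hIJ)
    (by
      intro I J hI hJ hlt
      by_contra! hcon
      refine absurd (hJ.ncard_le _ I hI.1 rfl fun e he => ?_) (by omega)
      by_contra hsp
      exact hcon e he (fun h => hsp (mem_edgeSpan_of_mem h (hI.1 h))) (hI.isForest_insert (hJ.1 he) hsp))
    (fun _ h => h.1)).matroid

/-- The cographic matroid of `G`: the dual of its cycle matroid. -/
def cographicMatroid [Finite β] (G : Graph α β) : Matroid β := G.cycleMatroid✶

end Graph

/-- Two elements (of the ground set, not loops) are parallel if they are equal or form a circuit. -/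
def Matroid.InParallel {β : Type*} (M : Matroid β) (e f : β) : Prop :=
  M.IsNonloop e ∧ M.IsNonloop f ∧ (e = f ∨ M.IsCircuit {e, f})

/-! ### Online algorithms and competitiveness in the zero information model -/

namespace MatroidSecretary

universe u v

/-- The average of `f` over a finite type, i.e. its expectation under the uniform distribution. -/
noncomputable def mean {Ω : Type*} (f : Ω → ℝ) : ℝ := (∑ᶠ ω, f ω) / Nat.card Ω

/-- A randomized online algorithm that only uses comparisons between weights. It draws a seed
uniformly from a finite set. When the element `e` arrives, the algorithm knows the seed, the list
`past` of the elements that arrived before (in order of arrival) and the relation `heavier` on the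
elements seen so far (`e` included), and accepts `e` or not. -/
structure OnlineAlgorithm (β : Type u) where
  Seed : Type v
  finite_seed : Finite Seed
  nonempty_seed : Nonempty Seed
  accept : Seed → (past : List β) → (heavier : β → β → Prop) → β → Prop

/-- The set accepted with seed `s` when the elements arrive in the order `arrival`. The relation
that is shown to the algorithm is restricted to the elements that have been seen. -/
def OnlineAlgorithm.accepted {β : Type u} (A : OnlineAlgorithm.{u, v} β) (s : A.Seed)
    (arrival : List β) (heavier : β → β → Prop) : Set β :=
  {e | ∃ past future, arrival = past ++ e :: future ∧
    A.accept s past (fun a b => a ∈ past ++ [e] ∧ b ∈ past ++ [e] ∧ heavier a b) e}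

/-- A linear ordering of the (finite) ground set of `M`. -/
abbrev Order {β : Type u} (M : Matroid β) : Type u := Fin M.E.ncard ≃ M.E

/-- `e` is heavier than `f`, where ties are broken in favour of the later element of `τ`. -/
def Heavier {β : Type u} {M : Matroid β} (w : β → ℝ) (τ : Order M) (e f : β) : Prop :=
  ∃ i j, (τ i : β) = e ∧ (τ j : β) = f ∧ (w f < w e ∨ w f = w e ∧ j < i)

/-- The output of `A` on the ground set of `M` with weights `w`, for the seed `s`, the order of
arrival `π` and the tie-breaking order `τ`. -/
def OnlineAlgorithm.output {β : Type u} (A : OnlineAlgorithm.{u, v} β) (M : Matroid β)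
    (w : β → ℝ) (s : A.Seed) (π τ : Order M) : Set β :=
  A.accepted s (List.ofFn fun i => (π i : β)) (Heavier w τ)

/-- `A` is `c`-competitive for `M` in the zero information model. For all nonnegative weights, the
output is always independent, and `c` times its expected weight is at least the weight of each
independent set, hence of the optimum. The seed, the order of arrival and the tie-breaking order
are uniform and independent. -/
def OnlineAlgorithm.IsCompetitive {β : Type u} (A : OnlineAlgorithm.{u, v} β) (M : Matroid β)
    (c : ℝ) : Prop :=
  ∀ w : β → ℝ, (∀ e ∈ M.E, 0 ≤ w e) →
    (∀ s π τ, M.Indep (A.output M w s π τ)) ∧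
    ∀ I, M.Indep I →
      ∑ᶠ e ∈ I, w e ≤
        c * mean fun ω : A.Seed × Order M × Order M =>
          ∑ᶠ e ∈ A.output M w ω.1 ω.2.1 ω.2.2, w e

open Classical in
/-- The secretary rule on `P`, for an arriving element `e` of `P`. The first `⌊|P| / exp 1⌋`
elements of `P` to arrive form the sample. A later element is accepted if it is heavier than all
the elements of `P` seen before and the heaviest of these, if there is any, is in the sample. -/
def SecretaryAccepts {β : Type u} (P : Set β) (past : List β) (heavier : β → β → Prop) (e : β) :
    Prop :=
  let seen := past.filter (· ∈ P)
  let m := ⌊(P.ncard : ℝ) / Real.exp 1⌋₊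
  m ≤ seen.length ∧ (∀ f ∈ seen, heavier e f) ∧
    ∀ f ∈ seen, (∀ g ∈ seen, g ≠ f → heavier f g) → f ∈ seen.take m

/-! ### The algorithms for cographic matroids -/

/-- The connected components (as vertex sets) of the graph that is left after the removal of all
bridges of `G`, which are the `2`-edge-connected components of `G`. -/
def Component {α : Type u} {β : Type v} (G : Graph α β) : Type u :=
  {X : Set α // ∃ x ∈ V(G), X =
    {y | (G.deleteEdges G.bridges).ReachVia E(G.deleteEdges G.bridges) x y}}

/-- A component, as a graph. -/
def Component.graph {α : Type u} {β : Type v} {G : Graph α β} (C : Component G) : Graph α β :=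
  (G.deleteEdges G.bridges).induce C.1

/-- `R` contains exactly one edge of each serial class of the cycle matroid of `H`; elements are
in series in a matroid if they are parallel in its dual. -/
def IsSerialTransversal {α : Type u} {β : Type v} [Finite β] (H : Graph α β) (R : Set β) : Prop :=
  R ⊆ E(H) ∧ ∀ e ∈ E(H), ∃! f, f ∈ R ∧ H.cycleMatroid✶.InParallel e f

/-- The graph obtained from `H` by contracting all edges but those of `R`. -/
def reducedGraph {α : Type u} {β : Type v} (H : Graph α β) (R : Set β) : Graph (Set α) β :=
  H.contractEdges (E(H) \ R)

/-- `B 0`, `B 1`, `B 2` are bases of the cographic matroid of `H` that cover the edges of `H`. -/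
def IsCobaseCover {α : Type u} {β : Type v} [Finite β] (H : Graph α β) (B : Fin 3 → Set β) :
    Prop :=
  (∀ i, H.cographicMatroid.IsBase (B i)) ∧ (⋃ i, B i) = E(H)

/-- The algorithm for `3`-edge-connected graphs: pick one of the sets `B 0`, `B 1`, `B 2` uniformly
at random and accept all its elements. -/
def coverAlgorithm {β : Type u} (B : Fin 3 → Set β) : OnlineAlgorithm.{u, 0} β where
  Seed := Fin 3
  finite_seed := inferInstance
  nonempty_seed := inferInstance
  accept i _ _ e := e ∈ B i

/-- The algorithm for arbitrary graphs. A uniform seed `i : Component G → Fin 3` amounts to an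
independent uniform index for each component `C`. An element `e` of `C` is discarded if its
parallel class `P` in the cographic matroid of `G` does not meet `B C (i C)`; otherwise the
secretary rule is run on `P`. Bridges lie in no component and are discarded. -/
def cographicAlgorithm {α : Type u} {β : Type v} [Finite α] [Finite β] (G : Graph α β)
    (B : Component G → Fin 3 → Set β) : OnlineAlgorithm.{v, u} β where
  Seed := Component G → Fin 3
  finite_seed :=
    have : Finite (Component G) := inferInstanceAs (Finite (Subtype _))
    inferInstance
  nonempty_seed := inferInstance
  accept i past heavier e :=
    ∃ C : Component G, e ∈ E(C.graph) ∧
      let P : Set β := {f | G.cographicMatroid.InParallel e f}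
      (P ∩ B C (i C)).Nonempty ∧ SecretaryAccepts P past heavier e

end MatroidSecretary

/-!
Write `M` for the cographic matroid of `G`. A set `X` of edges is independent in `M` iff the ends
of each edge of `X` are joined by a walk that avoids `X` (`Graph.cographicMatroid_indep_iff`), so
connectivity of `G` after the deletion of `X` is independence of `X` (for connected `G`).

*Structure.* Bridges are the loops of `M`, and `M` is the direct sum of these and of the cographic
matroids of the components `C` left after their removal
(`MatroidSecretary.Component.cographicMatroid_graph` and `cographicMatroid_indep_iUnion`), since
bridges are coloops of the cycle matroid and hence useless for spanning other edges. Contraction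
is deletion in the dual (`Graph.cographicMatroid_contractEdges`), so that the cographic matroid of
the reduced graph `C'` is the restriction of `M` to a transversal `R_C` of its parallel classes in
`C`. It is simple, and a connected graph with a simple cographic matroid has no disconnecting set
of at most two edges (`Graph.IsConnected.isEdgeConnected_three`).

*Covers.* A finite matroid is covered by `k` bases if `|X| ≤ k r(X)` for all `X`
(`Matroid.exists_isBase_iUnion_eq`, by augmenting paths). For the cographic matroid of a
3-edge-connected graph and `k = 3`, let `I` be a basis of `X`. The edges of `X \ I` join up the
components of `G - X`, so there are more than `|X \ I|` of these; if there are at least two, each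
has at least three edges of `X` on its boundary, and an edge is on two boundaries at most. Hence
`3 |X \ I| ≤ 2 |X|`, i.e. `|X| ≤ 3 |I|` (`Graph.IsEdgeConnected.ncard_le_three_mul`).

*Competitiveness.* An independent set contains at most one element of each parallel class. So
`c`-competitiveness follows if for each element that is not a loop, an element parallel to it and
not lighter is accepted with probability at least `1 / c`
(`MatroidSecretary.OnlineAlgorithm.isCompetitive_of_inParallel`). A parallel class meets the
cobase that is drawn with probability at least `1 / 3`, and then, independently, the secretary
rule selects its best element with probability at least `1 / e`. Indeed, for a class of size `k`
and a sample of size `m`, the best element has exactly `t ≥ m` predecessors, the best of which is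
in the sample, with probability `m / (k t)` (`MatroidSecretary.mul_ncard_best_at_second_at`), and
the sum over `t` is at least `1 / e` for `m = ⌊k / e⌋` by the trapezoid rule
(`MatroidSecretary.le_exp_one_mul_sum_Ico`); if `m = 0`, then the first element is taken, which is
the best one with probability `1 / k > 1 / e`. The output is independent, as at most one element
of each class is accepted (`MatroidSecretary.SecretaryAccepts.eq`) and the union of the cobases
drawn is independent in `M`. In a 3-edge-connected graph the parallel classes are singletons, for
which the rule never fails.
-/

open scoped Matroid

/-! ### Walks and the matroids of a multigraph -/

namespace Graph

variable {α β : Type*} {G : Graph α β} {F X : Set β} {e f : β} {x y : α}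

theorem ReachVia.of_isLink {α' : Type*} {H : Graph α' β} {F' : Set β} (φ : α → α')
    (h : ∀ e ∈ F, ∀ a b, G.IsLink e a b → H.ReachVia F' (φ a) (φ b)) (hxy : G.ReachVia F x y) :
    H.ReachVia F' (φ x) (φ y) := by
  induction hxy with
  | refl => exact .refl
  | tail _ hs ih =>
    obtain ⟨e, he, hl⟩ := hs
    exact ih.trans (h e he _ _ hl)

theorem IsLink.reachVia (h : G.IsLink e x y) (he : e ∈ F) : G.ReachVia F x y :=
  .single ⟨e, he, h⟩

theorem edgeSpan_subset : G.edgeSpan F ⊆ E(G) :=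
  fun _ ⟨_, _, hl, _⟩ => hl.edge_mem

theorem mem_bridges_iff : e ∈ G.bridges ↔ e ∈ E(G) ∧ e ∉ G.edgeSpan (E(G) \ {e}) := by
  refine and_congr_right fun _ => ⟨fun h ⟨x, y, hl, hr⟩ => h x y hl hr, fun h x y hl hr => ?_⟩
  exact h ⟨x, y, hl, hr⟩

section Finite

variable [Finite β]

@[simp] theorem cycleMatroid_indep_iff : G.cycleMatroid.Indep F ↔ G.IsForest F := by
  rw [cycleMatroid, IndepMatroid.matroid_Indep]
  exact iff_of_eq (congrFun (IndepMatroid.ofFinite_indep ..) F)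

@[simp] theorem cycleMatroid_ground : G.cycleMatroid.E = E(G) := rfl

@[simp] theorem cographicMatroid_ground : G.cographicMatroid.E = E(G) := rfl

theorem cycleMatroid_closure (hF : F ⊆ E(G)) : G.cycleMatroid.closure F = G.edgeSpan F := by
  obtain ⟨I, hI⟩ := G.cycleMatroid.exists_isBasis F hF
  have hIf : G.IsForest I := cycleMatroid_indep_iff.1 hI.indep
  have key : G.cycleMatroid.closure I = G.edgeSpan I := by
    ext e
    rw [hI.indep.mem_closure_iff']
    constructor
    · rintro ⟨heE, h⟩
      by_contra hsp
      exact hsp (mem_edgeSpan_of_mem (h (hIf.isForest_insert heE hsp)) heE)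
    · refine fun h => ⟨edgeSpan_subset h, fun hi => ?_⟩
      by_contra heI
      have hni := IsForest.notMem_edgeSpan (cycleMatroid_indep_iff.1 hi) (Set.mem_insert e I)
      exact hni (edgeSpan_mono (by
        intro g hg
        exact ⟨.inr hg, fun hge => heI (hge ▸ hg)⟩) h)
  rw [← hI.closure_eq_closure, key]
  refine (edgeSpan_mono hI.subset).antisymm (edgeSpan_trans ?_)
  rw [← key]
  exact hI.subset_closure

theorem cographicMatroid_indep_iff :
    G.cographicMatroid.Indep X ↔ X ⊆ E(G) ∧ X ⊆ G.edgeSpan (E(G) \ X) := by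
  by_cases hX : X ⊆ E(G)
  · have h := G.cycleMatroid.coindep_iff_closure_compl_eq_ground hX
    rw [Matroid.coindep_def, cycleMatroid_ground, cycleMatroid_closure Set.sdiff_subset] at h
    refine h.trans ⟨fun h => ⟨hX, by rw [h]; exact hX⟩,
      fun h => edgeSpan_subset.antisymm fun e he => ?_⟩
    by_cases heX : e ∈ X
    · exact h.2 heX
    · exact mem_edgeSpan_of_mem ⟨he, heX⟩ he
  · exact iff_of_false (fun h => hX h.subset_ground) fun h => hX h.1

theorem cographicMatroid_isNonloop_iff :
    G.cographicMatroid.IsNonloop e ↔ e ∈ E(G) ∧ e ∉ G.bridges := by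
  rw [← Matroid.indep_singleton, cographicMatroid_indep_iff, mem_bridges_iff]
  simp only [Set.singleton_subset_iff]
  tauto

theorem coloops_cycleMatroid : G.cycleMatroid.coloops = G.bridges := by
  ext e
  have h := cographicMatroid_isNonloop_iff (G := G) (e := e)
  by_cases he : e ∈ E(G)
  · rw [← Matroid.not_isLoop_iff he] at h
    have h' : ¬ G.cographicMatroid.IsLoop e ↔ e ∉ G.bridges := by simpa [he] using h
    exact not_iff_not.1 h'
  · exact iff_of_false (fun h' => he (G.cycleMatroid.coloops_subset_ground h')) fun h' => he h'.1

end Finite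

/-! ### Connectivity as a property of the cographic matroid -/

theorem IsEdgeConnected.isConnected {k : ℕ} (h : G.IsEdgeConnected k) (hk : 0 < k) :
    G.IsConnected := by
  simpa using h ∅ (Set.empty_subset _) (by simpa using hk)

section Finite

variable [Finite β]

theorem IsConnected.isConnected_deleteEdges_iff (hG : G.IsConnected) (hX : X ⊆ E(G)) :
    (G.deleteEdges X).IsConnected ↔ G.cographicMatroid.Indep X := by
  have hreach : ∀ a b, (G.deleteEdges X).ReachVia E(G.deleteEdges X) a b ↔
      G.ReachVia (E(G) \ X) a b := fun a b =>
    ⟨fun h => h.of_isLink id fun e he _ _ hl => IsLink.reachVia (by simp at hl; exact hl.1) he,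
      fun h => h.of_isLink id fun e he _ _ hl => IsLink.reachVia (by simp [hl]; exact he.2) he⟩
  rw [cographicMatroid_indep_iff, and_iff_right hX]
  constructor
  · intro h e he
    obtain ⟨x, y, hl⟩ := G.exists_isLink_of_mem_edgeSet (hX he)
    exact ⟨x, y, hl, (hreach x y).1 (h.2 x hl.left_mem y hl.right_mem)⟩
  · refine fun h => ⟨hG.1, fun x hx y hy => (hreach x y).2 ?_⟩
    refine (hG.2 x hx y hy).of_subset_edgeSpan fun e he _ => ?_
    by_cases heX : e ∈ X
    · exact h heX
    · exact mem_edgeSpan_of_mem ⟨he, heX⟩ he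

theorem IsEdgeConnected.cographicMatroid_indep {k : ℕ} (h : G.IsEdgeConnected k) (hX : X ⊆ E(G))
    (hk : X.encard < k) : G.cographicMatroid.Indep X := by
  have hk0 : 0 < k := by
    rcases Nat.eq_zero_or_pos k with rfl | h0
    · simp at hk
    · exact h0
  exact ((h.isConnected hk0).isConnected_deleteEdges_iff hX).1 (h X hX hk)

/-- A connected graph whose cographic matroid is simple is `3`-edge-connected, since a
disconnecting set of at most two edges contains a circuit of the cographic matroid. -/
theorem IsConnected.isEdgeConnected_three (hG : G.IsConnected)
    (h1 : ∀ e ∈ E(G), G.cographicMatroid.IsNonloop e)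
    (h2 : ∀ e f, G.cographicMatroid.InParallel e f → e = f) : G.IsEdgeConnected 3 := by
  intro F hF hcard
  rw [hG.isConnected_deleteEdges_iff hF]
  by_contra hdep
  obtain ⟨C, hCF, hC⟩ :=
    Matroid.Dep.exists_isCircuit_subset (M := G.cographicMatroid) (X := F) ⟨hdep, hF⟩
  have hC3 : C.encard < 3 := (Set.encard_le_encard hCF).trans_lt hcard
  have hfin : C.Finite := Set.toFinite C
  rw [← hfin.cast_ncard_eq] at hC3
  have hC3' : C.ncard < 3 := by exact_mod_cast hC3
  have hC0 : 0 < C.ncard := (Set.ncard_pos hfin).2 hC.nonempty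
  obtain h | h : C.ncard = 1 ∨ C.ncard = 2 := by omega
  · obtain ⟨e, rfl⟩ := Set.ncard_eq_one.1 h
    exact (h1 e (hC.subset_ground rfl)).not_isLoop (Matroid.singleton_isCircuit.1 hC)
  · obtain ⟨e, f, hne, rfl⟩ := Set.ncard_eq_two.1 h
    exact hne (h2 e f ⟨h1 e (hC.subset_ground (by simp)), h1 f (hC.subset_ground (by simp)),
      .inr hC⟩)

theorem IsEdgeConnected.eq_of_inParallel (hG : G.IsEdgeConnected 3)
    (h : G.cographicMatroid.InParallel e f) : e = f := by
  obtain ⟨-, -, rfl | h⟩ := h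
  · rfl
  · refine (h.not_indep (hG.cographicMatroid_indep h.subset_ground ?_)).elim
    refine (Set.encard_insert_le {f} e).trans_lt ?_
    rw [Set.encard_singleton]
    norm_num

end Finite

/-! ### Contraction -/

theorem edgeSet_contractEdges : E(G.contractEdges F) = E(G) \ F := rfl

theorem contractEdges_isLink {a b : Set α} : (G.contractEdges F).IsLink e a b ↔
    (∃ x y, G.IsLink e x y ∧ {z | G.ReachVia F x z} = a ∧ {z | G.ReachVia F y z} = b) ∧ e ∉ F :=
  by simp [contractEdges, Relation.Map]

theorem setOf_reachVia_eq (h : G.ReachVia F x y) :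
    {z | G.ReachVia F x z} = {z | G.ReachVia F y z} :=
  Set.ext fun _ => ⟨fun h' => h.symm.trans h', fun h' => h.trans h'⟩

theorem contractEdges_reachVia_iff {Y : Set β} (hY : Disjoint Y F) :
    (G.contractEdges F).ReachVia Y {z | G.ReachVia F x z} {z | G.ReachVia F y z} ↔
      G.ReachVia (Y ∪ F) x y := by
  constructor
  · have key : ∀ b, (G.contractEdges F).ReachVia Y {z | G.ReachVia F x z} b →
        ∀ z ∈ b, G.ReachVia (Y ∪ F) x z := by
      intro b hb
      induction hb with
      | refl => exact fun z hz => ReachVia.mono Set.subset_union_right hz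
      | tail _ hs ih =>
        obtain ⟨e, he, hl⟩ := hs
        obtain ⟨⟨u, v, huv, rfl, rfl⟩, -⟩ := contractEdges_isLink.1 hl
        intro z hz
        exact ((ih u .refl).trans (huv.reachVia (.inl he))).trans
          (ReachVia.mono Set.subset_union_right hz)
    exact fun h => key _ h y .refl
  · refine fun h => h.of_isLink (fun x => {z | G.ReachVia F x z}) fun e he a b hl => ?_
    obtain he | he := he
    · refine IsLink.reachVia (contractEdges_isLink.2 ⟨⟨a, b, hl, rfl, rfl⟩, ?_⟩) he
      exact Set.disjoint_left.1 hY he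
    · rw [setOf_reachVia_eq (hl.reachVia he)]
      exact .refl

theorem mem_edgeSpan_contractEdges_iff {Y : Set β} (hY : Disjoint Y F) :
    e ∈ (G.contractEdges F).edgeSpan Y ↔ e ∉ F ∧ e ∈ G.edgeSpan (Y ∪ F) := by
  constructor
  · rintro ⟨a, b, hl, hr⟩
    obtain ⟨⟨u, v, huv, rfl, rfl⟩, he⟩ := contractEdges_isLink.1 hl
    exact ⟨he, u, v, huv, (contractEdges_reachVia_iff hY).1 hr⟩
  · rintro ⟨he, u, v, huv, hr⟩
    exact ⟨_, _, contractEdges_isLink.2 ⟨⟨u, v, huv, rfl, rfl⟩, he⟩,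
      (contractEdges_reachVia_iff hY).2 hr⟩

theorem IsConnected.contractEdges (hG : G.IsConnected) (hF : F ⊆ E(G)) :
    (G.contractEdges F).IsConnected := by
  refine ⟨hG.1.image _, ?_⟩
  rintro - ⟨x, hx, rfl⟩ - ⟨y, hy, rfl⟩
  refine (contractEdges_reachVia_iff Set.disjoint_sdiff_left).2 ((hG.2 x hx y hy).mono ?_)
  exact (Set.sdiff_union_of_subset hF).ge

/-- Contraction of edges is deletion in the dual matroid. -/
theorem cographicMatroid_contractEdges [Finite β] (hF : F ⊆ E(G)) :
    (G.contractEdges F).cographicMatroid = G.cographicMatroid ↾ (E(G) \ F) := by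
  refine Matroid.ext_indep rfl fun X hX => ?_
  rw [cographicMatroid_ground, edgeSet_contractEdges] at hX
  rw [Matroid.restrict_indep_iff, and_iff_left hX, cographicMatroid_indep_iff,
    cographicMatroid_indep_iff, edgeSet_contractEdges, and_iff_right hX,
    and_iff_right (hX.trans Set.sdiff_subset)]
  have hd : Disjoint ((E(G) \ F) \ X) F :=
    Set.disjoint_left.2 fun e he => he.1.2
  have hu : (E(G) \ F) \ X ∪ F = E(G) \ X := by
    ext e
    have := @hX e
    have := @hF e
    simp only [Set.mem_union, Set.mem_sdiff] at *
    tauto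
  refine forall₂_congr fun e he => ?_
  rw [mem_edgeSpan_contractEdges_iff hd, hu, and_iff_right (hX he).2]

end Graph

/-! ### Parallel elements of a matroid -/

namespace Matroid

variable {β : Type*} {M : Matroid β} {e f g : β}

theorem inParallel_iff_closure_eq :
    M.InParallel e f ↔ M.IsNonloop e ∧ M.IsNonloop f ∧ M.closure {e} = M.closure {f} := by
  refine and_congr_right fun he => and_congr_right fun hf => ?_
  by_cases hef : e = f
  · simp [hef]
  · rw [he.closure_eq_closure_iff_isCircuit_of_ne hef]
    simp [hef]

theorem IsNonloop.inParallel_self (he : M.IsNonloop e) : M.InParallel e e :=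
  ⟨he, he, .inl rfl⟩

theorem InParallel.symm (h : M.InParallel e f) : M.InParallel f e := by
  rw [inParallel_iff_closure_eq] at *
  exact ⟨h.2.1, h.1, h.2.2.symm⟩

theorem InParallel.trans (h : M.InParallel e f) (h' : M.InParallel f g) : M.InParallel e g := by
  rw [inParallel_iff_closure_eq] at *
  exact ⟨h.1, h'.2.1, h.2.2.trans h'.2.2⟩

theorem InParallel.setOf_eq (h : M.InParallel e f) :
    {g | M.InParallel e g} = {g | M.InParallel f g} :=
  Set.ext fun _ => ⟨fun h' => h.symm.trans h', fun h' => h.trans h'⟩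

theorem InParallel.eq_of_indep (h : M.InParallel e f) {I : Set β} (hI : M.Indep I) (he : e ∈ I)
    (hf : f ∈ I) : e = f := by
  obtain ⟨-, -, rfl | h⟩ := h
  · rfl
  · exact (h.not_indep (hI.subset (Set.pair_subset he hf))).elim

theorem restrict_inParallel_iff {R : Set β} (hR : R ⊆ M.E) :
    (M ↾ R).InParallel e f ↔ M.InParallel e f ∧ e ∈ R ∧ f ∈ R := by
  simp only [InParallel, restrict_isNonloop_iff, restrict_isCircuit_iff hR, Set.pair_subset_iff]
  tauto

/-- Replacing the elements of an independent set by parallel elements keeps it independent. -/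
theorem Indep.of_injOn_inParallel [Finite β] {X Y : Set β} (hY : M.Indep Y) (φ : β → β)
    (hφ : ∀ e ∈ X, φ e ∈ Y ∧ M.InParallel e (φ e)) (hinj : Set.InjOn φ X) : M.Indep X := by
  have hX : X ⊆ M.E := fun e he => (hφ e he).2.1.mem_ground
  have hind : M.Indep (φ '' X) := hY.subset (by rintro - ⟨e, he, rfl⟩; exact (hφ e he).1)
  rw [indep_iff_eRk_eq_encard_of_finite (Set.toFinite X), ← eRk_closure_eq]
  have : M.closure X = M.closure (φ '' X) := by
    have h := M.closure_biUnion_congr (fun e => {e}) (fun e => {φ e}) X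
      fun e he => (inParallel_iff_closure_eq.1 (hφ e he).2).2.2
    simpa [← Set.image_eq_iUnion] using h
  rw [this, eRk_closure_eq, hind.eRk_eq_encard, hinj.encard_image]

end Matroid

/-! ### The components left after the removal of all bridges -/

namespace MatroidSecretary.Component

open Graph Matroid

variable {α β : Type*} {G : Graph α β} {e f : β} {x y : α}

theorem graph_isLink {C : Component G} :
    C.graph.IsLink e x y ↔ (G.IsLink e x y ∧ e ∉ G.bridges) ∧ x ∈ C.1 ∧ y ∈ C.1 := by
  simp [Component.graph]

theorem mem_of_reachVia {C : Component G} (hx : x ∈ C.1)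
    (h : (G.deleteEdges G.bridges).ReachVia E(G.deleteEdges G.bridges) x y) : y ∈ C.1 := by
  obtain ⟨x₀, -, hC⟩ := C.2
  rw [hC] at hx ⊢
  exact Relation.ReflTransGen.trans hx h

theorem mem_of_isLink {C : Component G} (hx : x ∈ C.1) (h : G.IsLink e x y)
    (he : e ∉ G.bridges) : y ∈ C.1 :=
  C.mem_of_reachVia hx (.single ⟨e, ⟨h.edge_mem, he⟩, by simp [h, he]⟩)

theorem mem_edgeSet_of_isLink {C : Component G} (hx : x ∈ C.1) (h : G.IsLink e x y)
    (he : e ∉ G.bridges) : e ∈ E(C.graph) :=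
  (graph_isLink.2 ⟨⟨h, he⟩, hx, C.mem_of_isLink hx h he⟩).edge_mem

theorem edgeSet_subset (C : Component G) : E(C.graph) ⊆ E(G) \ G.bridges := by
  intro e he
  obtain ⟨x, y, hl⟩ := C.graph.exists_isLink_of_mem_edgeSet he
  exact ⟨(graph_isLink.1 hl).1.1.edge_mem, (graph_isLink.1 hl).1.2⟩

theorem exists_mem_edgeSet (he : e ∈ E(G)) (hb : e ∉ G.bridges) :
    ∃ C : Component G, e ∈ E(C.graph) := by
  obtain ⟨x, y, hl⟩ := G.exists_isLink_of_mem_edgeSet he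
  exact ⟨⟨_, x, hl.left_mem, rfl⟩, mem_edgeSet_of_isLink (x := x) .refl hl hb⟩

theorem eq_of_mem_of_mem {C C' : Component G} (h : x ∈ C.1) (h' : x ∈ C'.1) : C = C' := by
  have key : ∀ C : Component G, x ∈ C.1 → C.1 =
      {y | (G.deleteEdges G.bridges).ReachVia E(G.deleteEdges G.bridges) x y} := by
    intro C hx
    obtain ⟨x₀, -, hC⟩ := C.2
    rw [hC] at hx ⊢
    exact setOf_reachVia_eq hx
  exact Subtype.ext ((key C h).trans (key C' h').symm)

theorem eq_of_mem_edgeSet {C C' : Component G} (h : e ∈ E(C.graph)) (h' : e ∈ E(C'.graph)) :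
    C = C' := by
  obtain ⟨x, y, hl⟩ := C.graph.exists_isLink_of_mem_edgeSet h
  obtain ⟨x', y', hl'⟩ := C'.graph.exists_isLink_of_mem_edgeSet h'
  rw [graph_isLink] at hl hl'
  refine eq_of_mem_of_mem hl.2.1 ?_
  obtain ⟨rfl, rfl⟩ | ⟨rfl, rfl⟩ := hl.1.1.eq_and_eq_or_eq_and_eq hl'.1.1
  exacts [hl'.2.1, hl'.2.2]

theorem isConnected (C : Component G) : C.graph.IsConnected := by
  obtain ⟨x₀, hx₀, hC⟩ := C.2
  have hx₀C : x₀ ∈ C.1 := hC ▸ .refl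
  have key : ∀ y ∈ C.1, C.graph.ReachVia E(C.graph) x₀ y := by
    intro y hy
    rw [hC] at hy
    induction hy with
    | refl => exact .refl
    | @tail a b hr hs ih =>
      obtain ⟨e, he, hl⟩ := hs
      simp only [deleteEdges_isLink] at hl
      have ha : a ∈ C.1 := mem_of_reachVia hx₀C hr
      exact ih.trans (IsLink.reachVia
        (graph_isLink.2 ⟨hl, ha, C.mem_of_isLink ha hl.1 hl.2⟩)
        (mem_edgeSet_of_isLink ha hl.1 hl.2))
  exact ⟨⟨x₀, hx₀C⟩, fun x hx y hy => (key x hx).symm.trans (key y hy)⟩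

variable [Finite β]

/-- A cycle through an edge of a component stays in the component: bridges are coloops of the
cycle matroid, so they do not help to span other edges. -/
theorem mem_edgeSpan_iff (C : Component G) {X : Set β} (he : e ∈ E(C.graph)) :
    e ∈ G.edgeSpan (E(G) \ X) ↔ e ∈ C.graph.edgeSpan (E(C.graph) \ X) := by
  obtain ⟨heE, heb⟩ := C.edgeSet_subset he
  constructor
  · intro h
    have hcl := G.cycleMatroid.closure_sdiff_eq_of_subset_coloops (E(G) \ X) (K := G.bridges)
      coloops_cycleMatroid.ge
    rw [cycleMatroid_closure Set.sdiff_subset,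
      cycleMatroid_closure (Set.sdiff_subset.trans Set.sdiff_subset)] at hcl
    have h' : e ∈ G.edgeSpan ((E(G) \ X) \ G.bridges) := hcl ▸ ⟨h, heb⟩
    obtain ⟨x, y, hl⟩ := C.graph.exists_isLink_of_mem_edgeSet he
    have hr := reachVia_of_mem_edgeSpan h' (graph_isLink.1 hl).1.1
    refine ⟨x, y, hl, ?_⟩
    have hxC := (graph_isLink.1 hl).2.1
    suffices h : y ∈ C.1 ∧ C.graph.ReachVia (E(C.graph) \ X) x y from h.2
    clear hl
    induction hr with
    | refl => exact ⟨hxC, .refl⟩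
    | tail _ hs ih =>
      obtain ⟨f, hf, hl⟩ := hs
      have hbC := C.mem_of_isLink ih.1 hl hf.2
      exact ⟨hbC, ih.2.trans (IsLink.reachVia (graph_isLink.2 ⟨⟨hl, hf.2⟩, ih.1, hbC⟩)
        ⟨mem_edgeSet_of_isLink ih.1 hl hf.2, hf.1.2⟩)⟩
  · rintro ⟨x, y, hl, hr⟩
    refine ⟨x, y, (graph_isLink.1 hl).1.1, hr.of_isLink id fun f hf a b hl => ?_⟩
    exact (graph_isLink.1 hl).1.1.reachVia ⟨(C.edgeSet_subset hf.1).1, hf.2⟩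

theorem cographicMatroid_graph (C : Component G) :
    C.graph.cographicMatroid = G.cographicMatroid ↾ E(C.graph) := by
  refine Matroid.ext_indep rfl fun X hX => ?_
  rw [cographicMatroid_ground] at hX
  rw [Matroid.restrict_indep_iff, and_iff_left hX, cographicMatroid_indep_iff,
    cographicMatroid_indep_iff, and_iff_right hX,
    and_iff_right (hX.trans (C.edgeSet_subset.trans Set.sdiff_subset))]
  exact forall₂_congr fun e he => (C.mem_edgeSpan_iff (hX he)).symm

/-- The cographic matroids of the components form a direct sum: a union of independent sets of
different components is independent. -/
theorem cographicMatroid_indep_iUnion {B : Component G → Set β}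
    (hB : ∀ C : Component G, C.graph.cographicMatroid.Indep (B C)) :
    G.cographicMatroid.Indep (⋃ C, B C) := by
  simp only [cographicMatroid_indep_iff] at hB
  rw [cographicMatroid_indep_iff]
  refine ⟨Set.iUnion_subset fun C => (hB C).1.trans (C.edgeSet_subset.trans Set.sdiff_subset),
    Set.iUnion_subset fun C e he => ?_⟩
  rw [C.mem_edgeSpan_iff ((hB C).1 he)]
  refine edgeSpan_mono ?_ ((hB C).2 he)
  intro f hf
  refine ⟨hf.1, fun hfU => ?_⟩
  obtain ⟨C', hfC'⟩ := Set.mem_iUnion.1 hfU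
  obtain rfl := eq_of_mem_edgeSet hf.1 ((hB C').1 hfC')
  exact hf.2 hfC'

theorem graph_inParallel_iff (C : Component G) : C.graph.cographicMatroid.InParallel e f ↔
    G.cographicMatroid.InParallel e f ∧ e ∈ E(C.graph) ∧ f ∈ E(C.graph) := by
  rw [cographicMatroid_graph]
  exact restrict_inParallel_iff (C.edgeSet_subset.trans Set.sdiff_subset)

theorem isNonloop_of_mem {C : Component G} (he : e ∈ E(C.graph)) :
    G.cographicMatroid.IsNonloop e :=
  cographicMatroid_isNonloop_iff.2 (C.edgeSet_subset he)

/-- Parallel elements of the cographic matroid lie in the same component. -/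
theorem mem_edgeSet_of_inParallel {C : Component G} (he : e ∈ E(C.graph))
    (h : G.cographicMatroid.InParallel e f) : f ∈ E(C.graph) := by
  by_contra hf
  have hfn := cographicMatroid_isNonloop_iff.1 h.2.1
  obtain ⟨C', hC'⟩ := exists_mem_edgeSet hfn.1 hfn.2
  have hne : C ≠ C' := by rintro rfl; exact hf hC'
  -- `e` and `f` lie in different summands, so they are independent
  have hind : G.cographicMatroid.Indep (⋃ D : Component G, E(D.graph) ∩ {e, f}) := by
    refine cographicMatroid_indep_iUnion fun D => ?_
    rw [cographicMatroid_graph, restrict_indep_iff, and_iff_left Set.inter_subset_left]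
    have hs : (E(D.graph) ∩ {e, f}).Subsingleton := by
      rintro a ⟨ha, rfl | rfl⟩ b ⟨hb, rfl | rfl⟩
      · rfl
      · exact (hne ((eq_of_mem_edgeSet he ha).trans (eq_of_mem_edgeSet hb hC'))).elim
      · exact (hne ((eq_of_mem_edgeSet he hb).trans (eq_of_mem_edgeSet ha hC'))).elim
      · rfl
    obtain h0 | ⟨a, ha⟩ := hs.eq_empty_or_singleton
    · rw [h0]; exact Matroid.empty_indep _
    · rw [ha, indep_singleton]
      exact isNonloop_of_mem (C := D) (ha.ge rfl).1
  have := h.eq_of_indep hind (Set.mem_iUnion.2 ⟨C, he, by simp⟩)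
    (Set.mem_iUnion.2 ⟨C', hC', by simp⟩)
  exact hf (this ▸ he)

theorem exists_isSerialTransversal (C : Component G) :
    ∃ R : Set β, IsSerialTransversal C.graph R := by
  classical
  change ∃ R : Set β, R ⊆ E(C.graph) ∧
    ∀ e ∈ E(C.graph), ∃! f, f ∈ R ∧ C.graph.cographicMatroid.InParallel e f
  have hself : ∀ e ∈ E(C.graph), C.graph.cographicMatroid.InParallel e e := fun e he =>
    C.graph_inParallel_iff.2 ⟨(isNonloop_of_mem he).inParallel_self, he, he⟩
  -- the representative depends on the parallel class as a set only
  let r : Set β → β → β := fun P e => if h : P.Nonempty then h.some else e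
  have hr : ∀ e ∈ E(C.graph), C.graph.cographicMatroid.InParallel e
      (r {f | C.graph.cographicMatroid.InParallel e f} e) := by
    intro e he
    have hne : {f | C.graph.cographicMatroid.InParallel e f}.Nonempty := ⟨e, hself e he⟩
    simp only [r, dif_pos hne]
    exact hne.some_mem
  have hreq : ∀ e f, C.graph.cographicMatroid.InParallel e f →
      r {f | C.graph.cographicMatroid.InParallel e f} e =
        r {g | C.graph.cographicMatroid.InParallel f g} f := by
    intro e f h
    have hne : {g | C.graph.cographicMatroid.InParallel f g}.Nonempty := ⟨e, h.symm⟩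
    rw [h.setOf_eq]
    simp only [r, dif_pos hne]
  refine ⟨(fun e => r {f | C.graph.cographicMatroid.InParallel e f} e) '' E(C.graph), ?_, ?_⟩
  · rintro - ⟨e, he, rfl⟩
    exact (hr e he).2.1.mem_ground
  · refine fun e he => ⟨_, ⟨⟨e, he, rfl⟩, hr e he⟩, ?_⟩
    rintro - ⟨⟨g, hg, rfl⟩, heg⟩
    exact hreq _ _ ((hr g hg).trans heg.symm)

section Reduced

variable {R : Set β}

theorem cographicMatroid_reducedGraph (C : Component G) (hR : IsSerialTransversal C.graph R) :
    (reducedGraph C.graph R).cographicMatroid = C.graph.cographicMatroid ↾ R := by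
  rw [reducedGraph, cographicMatroid_contractEdges Set.sdiff_subset,
    Set.sdiff_sdiff_cancel_left hR.1]

theorem edgeSet_reducedGraph (C : Component G) (hR : IsSerialTransversal C.graph R) :
    E(reducedGraph C.graph R) = R := by
  rw [reducedGraph, edgeSet_contractEdges, Set.sdiff_sdiff_cancel_left hR.1]

/-- Keeping one edge of each serial class makes the cographic matroid simple. -/
theorem isEdgeConnected_reducedGraph (C : Component G) (hR : IsSerialTransversal C.graph R) :
    (reducedGraph C.graph R).IsEdgeConnected 3 := by
  have hpar : ∀ e f, (reducedGraph C.graph R).cographicMatroid.InParallel e f ↔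
      C.graph.cographicMatroid.InParallel e f ∧ e ∈ R ∧ f ∈ R := by
    intro e f
    rw [C.cographicMatroid_reducedGraph hR]
    exact restrict_inParallel_iff hR.1
  refine IsConnected.isEdgeConnected_three (C.isConnected.contractEdges Set.sdiff_subset) ?_ ?_
  · intro e he
    change e ∈ E(reducedGraph C.graph R) at he
    rw [C.edgeSet_reducedGraph hR] at he
    obtain ⟨f, ⟨hf, hef⟩, -⟩ := hR.2 e (hR.1 he)
    exact ((hpar e f).2 ⟨hef, he, hf⟩).1
  · intro e f h
    obtain ⟨h, he, hf⟩ := (hpar e f).1 h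
    exact (hR.2 e (hR.1 he)).unique ⟨he, h.1.inParallel_self⟩ ⟨hf, h⟩

end Reduced

end MatroidSecretary.Component

/-! ### Covering a matroid by bases -/

namespace Matroid

variable {β ι : Type*} {M : Matroid β} {c : β → Option ι}

/-- A partial colouring of the elements of `M`, `none` meaning uncoloured, all of whose colour
classes are independent. -/
def IsIndepColoring (M : Matroid β) (c : β → Option ι) : Prop :=
  ∀ i, M.Indep {x | c x = some i}

/-- The element `f` can be given a new colour without any other change. -/
def CanRecolor (M : Matroid β) (c : β → Option ι) (f : β) : Prop :=
  ∃ j, c f ≠ some j ∧ M.Indep (insert f {x | c x = some j})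

/-- The element `f` can be given the colour of `g`, once `g` loses it. -/
def CanReplace (M : Matroid β) (c : β → Option ι) (f g : β) : Prop :=
  ∃ l, c g = some l ∧ c f ≠ some l ∧ M.Indep (insert f ({x | c x = some l} \ {g}))

theorem IsIndepColoring.update [DecidableEq β] (hc : M.IsIndepColoring c) {f : β} {j : ι}
    (h : M.Indep (insert f {x | c x = some j})) :
    M.IsIndepColoring (Function.update c f (some j)) := by
  intro l
  by_cases hl : l = j
  · subst hl
    refine h.subset fun x hx => ?_
    by_cases hxf : x = f
    · exact .inl hxf
    · exact .inr (by simpa [hxf] using hx)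
  · refine (hc l).subset fun x hx => ?_
    have hxf : x ≠ f := by
      rintro rfl
      simp at hx
      exact hl hx.symm
    simpa [hxf] using hx

/-- Augmentation along a path `p 0, …, p n`, each element of which can replace the next one, and
whose last element can be recoloured. If no earlier element can be recoloured, then recolouring
`p n` leaves a path to `p (n - 1)`, so that one can go on by induction. -/
theorem IsIndepColoring.exists_augment {n : ℕ} (hc : M.IsIndepColoring c) {p : ℕ → β}
    (h0 : c (p 0) = none) (hp : ∀ s < n, M.CanReplace c (p s) (p (s + 1)))
    (hn : M.CanRecolor c (p n)) :
    ∃ c' : β → Option ι, M.IsIndepColoring c' ∧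
      {x | c' x ≠ none} = insert (p 0) {x | c x ≠ none} := by
  classical
  induction n using Nat.strong_induction_on generalizing c with
  | _ n ih =>
  obtain _ | n := n
  · obtain ⟨j, -, hj⟩ := hn
    refine ⟨Function.update c (p 0) (some j), hc.update hj, ?_⟩
    ext x
    by_cases hx : x = p 0 <;> simp [hx]
  by_cases hs : ∃ s ≤ n, M.CanRecolor c (p s)
  · obtain ⟨s, hsn, hs⟩ := hs
    exact ih s (by omega) hc h0 (fun t ht => hp t (by omega)) hs
  push Not at hs
  obtain ⟨j, hfj, hj⟩ := hn
  have hne : ∀ s ≤ n, p s ≠ p (n + 1) := fun s hsn h => hs s hsn (h ▸ ⟨j, hfj, hj⟩)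
  obtain ⟨i, hfi, hni, hi⟩ := hp n (by omega)
  have hij : i ≠ j := fun h => hfj (h ▸ hfi)
  have hc' : ∀ s ≤ n, Function.update c (p (n + 1)) (some j) (p s) = c (p s) :=
    fun s hsn => Function.update_of_ne (hne s hsn) _ _
  suffices h : (∀ s < n, M.CanReplace (Function.update c (p (n + 1)) (some j)) (p s) (p (s + 1))) ∧
      M.CanRecolor (Function.update c (p (n + 1)) (some j)) (p n) by
    obtain ⟨c', hc'v, hc'eq⟩ :=
      ih n (by omega) (hc.update hj) (by rw [hc' 0 (by omega), h0]) h.1 h.2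
    refine ⟨c', hc'v, hc'eq.trans ?_⟩
    congr 1
    ext x
    by_cases hx : x = p (n + 1) <;> simp [hx, hfi]
  refine ⟨fun s hsn => ?_, ?_⟩
  · obtain ⟨l, hgl, hfl, hl⟩ := hp s (by omega)
    refine ⟨l, by rw [hc' _ (by omega), hgl], by rwa [hc' _ (by omega)], ?_⟩
    by_cases hlj : l = j
    · subst hlj
      have hh : p s ∈ M.E := hl.subset_ground (by simp)
      have hcl : p s ∈ M.closure {x | c x = some l} := by
        by_contra hcl
        exact hs s (by omega) ⟨l, hfl, ((hc l).insert_indep_iff).2 (.inl ⟨hh, hcl⟩)⟩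
      have hf : p (n + 1) ∈ M.E \ M.closure {x | c x = some l} :=
        ((hc l).insert_indep_iff_of_notMem hfj).1 hj
      have : M.Indep (insert (p (n + 1)) (insert (p s) ({x | c x = some l} \ {p (s + 1)}))) := by
        refine hl.insert_indep_iff.2 (.inl ⟨hf.1, fun h => hf.2 ?_⟩)
        refine M.closure_subset_closure_of_subset_closure (Set.insert_subset hcl ?_) h
        exact Set.sdiff_subset.trans (M.subset_closure _ (hc l).subset_ground)
      refine this.subset ?_
      rintro x (rfl | ⟨hx, hxg⟩)
      · simp
      by_cases hxf : x = p (n + 1)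
      · exact .inl hxf
      · exact .inr (.inr ⟨by simpa [hxf] using hx, hxg⟩)
    · refine hl.subset (Set.insert_subset_insert (Set.sdiff_subset_sdiff_left fun x hx => ?_))
      have hxf : x ≠ p (n + 1) := by
        rintro rfl
        simp at hx
        exact hlj hx.symm
      simpa [hxf] using hx
  · refine ⟨i, by rwa [hc' n le_rfl], hi.subset (Set.insert_subset_insert fun x hx => ?_)⟩
    have hxf : x ≠ p (n + 1) := by
      rintro rfl
      simp at hx
      exact hij hx.symm
    exact ⟨by simpa [hxf] using hx, hxf⟩

/-- The covering case of Edmonds' matroid partition theorem: if every set `X` has at most `k`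
times as many elements as a basis of `X`, then `k` bases cover the ground set. -/
theorem exists_isBase_iUnion_eq [Finite β] [Fintype ι]
    (h : ∀ X I, M.IsBasis I X → X.ncard ≤ Fintype.card ι * I.ncard) :
    ∃ B : ι → Set β, (∀ i, M.IsBase (B i)) ∧ ⋃ i, B i = M.E := by
  classical
  obtain ⟨c, hc, hmax⟩ := Set.exists_max_image
    {c : β → Option ι | M.IsIndepColoring c} (fun c => {x | c x ≠ none}.ncard) (Set.toFinite _)
    ⟨fun _ => none, fun i => by simp⟩
  suffices hall : ∀ e ∈ M.E, c e ≠ none by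
    choose B hB hcB using fun i => (hc i).exists_isBase_superset
    refine ⟨B, hB, (Set.iUnion_subset fun i => (hB i).subset_ground).antisymm fun e he => ?_⟩
    obtain ⟨i, hi⟩ := Option.ne_none_iff_exists'.1 (hall e he)
    exact Set.mem_iUnion.2 ⟨i, hcB i hi⟩
  intro e heE hce
  -- the elements reachable from the uncoloured element `e` violate the hypothesis
  let X : Set β := {f | ∃ (n : ℕ) (p : ℕ → β), p 0 = e ∧ p n = f ∧
    ∀ s < n, M.CanReplace c (p s) (p (s + 1))}
  have heX : e ∈ X := ⟨0, fun _ => e, rfl, rfl, by simp⟩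
  have hstep : ∀ f ∈ X, ∀ g, M.CanReplace c f g → g ∈ X := by
    rintro f ⟨n, p, hp0, hpn, hp⟩ g hfg
    refine ⟨n + 1, fun s => if s ≤ n then p s else g, by simpa, by simp, fun s hs => ?_⟩
    obtain hs | rfl := Nat.lt_succ_iff_lt_or_eq.1 hs
    · simp only [show s ≤ n by omega, show s + 1 ≤ n by omega, if_true]
      exact hp s hs
    · simpa [hpn] using hfg
  have hsink : ∀ f ∈ X, ¬ M.CanRecolor c f := by
    rintro f ⟨n, p, hp0, rfl, hp⟩ hf
    obtain ⟨c', hc', heq⟩ := hc.exists_augment (hp0 ▸ hce) hp hf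
    have := hmax c' hc'
    rw [heq, hp0, Set.ncard_insert_of_notMem (by simpa using hce) (Set.toFinite _)] at this
    omega
  have hXE : X ⊆ M.E := by
    rintro f ⟨n, p, hp0, rfl, hp⟩
    obtain _ | n := n
    · exact hp0 ▸ heE
    · obtain ⟨l, hl, -⟩ := hp n (by omega)
      exact (hc l).subset_ground hl
  have hbasis : ∀ i, M.IsBasis ({x | c x = some i} ∩ X) X := by
    intro i
    refine ((hc i).subset Set.inter_subset_left).isBasis_of_subset_of_subset_closure
      Set.inter_subset_right fun f hf => ?_
    by_cases hfi : c f = some i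
    · exact M.mem_closure_of_mem' ⟨hfi, hf⟩ (hXE hf)
    have hcl : f ∈ M.closure {x | c x = some i} := by
      by_contra hcl
      exact hsink f hf ⟨i, hfi, ((hc i).insert_indep_iff).2 (.inl ⟨hXE hf, hcl⟩)⟩
    refine M.closure_subset_closure ?_
      (((hc i).fundCircuit_isCircuit hcl hfi).mem_closure_sdiff_singleton_of_mem
        (M.mem_fundCircuit f _))
    rintro g ⟨hg, hgf⟩
    have hgi : c g = some i := (M.fundCircuit_subset_insert f _ hg).resolve_left hgf
    have hgf' : f ≠ g := fun h => hgf h.symm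
    refine ⟨hgi, hstep f hf g ⟨i, hgi, hfi, ?_⟩⟩
    have := ((hc i).mem_fundCircuit_iff hcl hfi).1 hg
    rwa [Set.insert_sdiff_of_notMem _ (by simpa using hgf')] at this
  have := Fintype.ofFinite β
  have hcount : X.ncard = ({x | c x = none} ∩ X).ncard +
      ∑ i, ({x | c x = some i} ∩ X).ncard := by
    have hf := Finset.card_eq_sum_card_fiberwise (f := c) (s := X.toFinset) (t := Finset.univ)
      (fun _ _ => Finset.mem_coe.2 (Finset.mem_univ _))
    rw [Fintype.sum_option] at hf
    have hconv : ∀ o, ({x | c x = o} ∩ X).ncard = (X.toFinset.filter (c · = o)).card := by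
      intro o
      rw [← Set.ncard_coe_finset]
      congr 1
      ext x
      simp [and_comm]
    simp only [hconv]
    rw [← hf, Set.ncard_eq_toFinset_card']
  have hpos : 0 < ({x | c x = none} ∩ X).ncard := (Set.ncard_pos (Set.toFinite _)).2 ⟨e, hce, heX⟩
  obtain ⟨I, hI⟩ := M.exists_isBasis X hXE
  have hIcard : ∀ i, ({x | c x = some i} ∩ X).ncard = I.ncard := fun i => by
    rw [Set.ncard, Set.ncard, (hbasis i).encard_eq_encard hI]
  have hle := h X I hI
  simp only [hIcard, Finset.sum_const, Finset.card_univ, smul_eq_mul] at hcount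
  omega

end Matroid

/-! ### Covers of a 3-edge-connected graph by complements of spanning trees -/

namespace Graph

variable {α β : Type*} {G : Graph α β} {F K D X : Set β} {d : β}

/-- The vertex sets of the components of the subgraph with edge set `F`. -/
def walkClasses (G : Graph α β) (F : Set β) : Set (Set α) :=
  (fun x => {y | G.ReachVia F x y}) '' V(G)

/-- The edges of `G` that leave `A`. -/
def boundary (G : Graph α β) (A : Set α) : Set β :=
  {e | ∃ x y, G.IsLink e x y ∧ x ∈ A ∧ y ∉ A}

theorem ncard_walkClasses_insert_lt [Finite α] (hd : d ∈ E(G)) (hF : d ∉ G.edgeSpan F) :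
    (G.walkClasses (insert d F)).ncard < (G.walkClasses F).ncard := by
  obtain ⟨a, b, hab⟩ := G.exists_isLink_of_mem_edgeSet hd
  let φ : Set α → Set α := fun A => {y | ∃ x ∈ A, G.ReachVia (insert d F) x y}
  have hφ : ∀ x, φ {y | G.ReachVia F x y} = {y | G.ReachVia (insert d F) x y} := fun x =>
    Set.ext fun y => ⟨fun ⟨z, hz, hzy⟩ => (hz.mono (Set.subset_insert d F)).trans hzy,
      fun h => ⟨x, .refl, h⟩⟩
  have himage : G.walkClasses (insert d F) = φ '' G.walkClasses F := by
    rw [walkClasses, walkClasses, Set.image_image]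
    simp only [hφ]
  rw [himage]
  refine lt_of_le_of_ne (Set.ncard_image_le (Set.toFinite _)) fun h => hF ?_
  have hinj := (Set.ncard_image_iff (Set.toFinite _)).1 h
  have heq := hinj ⟨a, hab.left_mem, rfl⟩ ⟨b, hab.right_mem, rfl⟩ (by
    simp only [hφ]
    exact setOf_reachVia_eq (hab.reachVia (.inl rfl)))
  have hb : b ∈ {y | G.ReachVia F b y} := .refl
  rw [show {y | G.ReachVia F b y} = _ from heq.symm] at hb
  exact ⟨a, b, hab, hb⟩

/-- If no edge of `D` is spanned by `K` and the rest of `D`, then adding the edges of `D` to `K` one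
by one joins two components each time. -/
theorem ncard_add_ncard_walkClasses_le [Finite α] [Finite β] (hD : D ⊆ E(G))
    (h : ∀ d ∈ D, d ∉ G.edgeSpan (K ∪ D \ {d})) :
    D.ncard + (G.walkClasses (K ∪ D)).ncard ≤ (G.walkClasses K).ncard := by
  induction D, Set.toFinite D using Set.Finite.induction_on with
  | empty => simp
  | @insert d D hdD _ ih =>
    have ih := ih ((Set.subset_insert d D).trans hD) fun d' hd' hsp =>
      h d' (.inr hd') (edgeSpan_mono (Set.union_subset_union_right K
        (Set.sdiff_subset_sdiff_left (Set.subset_insert d D))) hsp)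
    have hlt := ncard_walkClasses_insert_lt (G := G) (F := K ∪ D) (d := d) (hD (.inl rfl))
      (by simpa [hdD] using h d (.inl rfl))
    rw [Set.ncard_insert_of_notMem hdD (Set.toFinite _), Set.union_insert]
    omega

theorem IsEdgeConnected.three_le_ncard_boundary [Finite β] (hG : G.IsEdgeConnected 3) {A : Set α}
    {x y : α} (hx : x ∈ V(G)) (hy : y ∈ V(G)) (hxA : x ∈ A) (hyA : y ∉ A) :
    3 ≤ (G.boundary A).ncard := by
  by_contra! hlt
  have hsub : G.boundary A ⊆ E(G) := fun e ⟨_, _, hl, _⟩ => hl.edge_mem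
  have hconn := hG (G.boundary A) hsub (by
    rw [← (Set.toFinite (G.boundary A)).cast_ncard_eq]
    exact_mod_cast hlt)
  refine hyA ?_
  have hr := hconn.2 x hx y hy
  clear hy hyA
  induction hr with
  | refl => exact hxA
  | @tail a b _ hs ih =>
    obtain ⟨e, -, hl⟩ := hs
    rw [deleteEdges_isLink] at hl
    by_contra hb
    exact hl.2 ⟨a, b, hl.1, ih, hb⟩

/-- Each component of `G - X` has three edges of `X` on its boundary, and each edge is on the
boundary of at most two components. -/
theorem IsEdgeConnected.three_mul_ncard_walkClasses_le [Finite α] [Finite β]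
    (hG : G.IsEdgeConnected 3) (hne : (G.walkClasses (E(G) \ X)).Nontrivial) :
    3 * (G.walkClasses (E(G) \ X)).ncard ≤ 2 * X.ncard := by
  classical
  have := Fintype.ofFinite β
  have := Fintype.ofFinite (Set α)
  rw [Set.ncard_eq_toFinset_card', Set.ncard_eq_toFinset_card', mul_comm 3, mul_comm 2]
  refine Finset.card_mul_le_card_mul (fun A e => e ∈ G.boundary A) ?_ ?_
  · intro A hA
    rw [Set.mem_toFinset] at hA
    obtain ⟨A', ⟨y, hy, rfl⟩, hne'⟩ := hne.exists_ne A
    obtain ⟨x, hx, rfl⟩ := hA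
    have h3 := hG.three_le_ncard_boundary (A := {z | G.ReachVia (E(G) \ X) x z}) hx hy .refl
      fun h => hne' (setOf_reachVia_eq h).symm
    refine h3.trans ?_
    rw [← Set.ncard_coe_finset]
    refine Set.ncard_le_ncard (fun e he => ?_) (Set.toFinite _)
    refine Finset.mem_coe.2 (Finset.mem_filter.2 ⟨Set.mem_toFinset.2 ?_, he⟩)
    obtain ⟨u, v, huv, hu, hv⟩ := he
    by_contra heX
    exact hv (ReachVia.mono subset_rfl
      (Relation.ReflTransGen.trans hu (huv.reachVia ⟨huv.edge_mem, heX⟩)))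
  · -- only the classes of its two ends can have a given edge in their boundary
    intro e _
    by_cases he : e ∈ E(G)
    · obtain ⟨u, v, huv⟩ := G.exists_isLink_of_mem_edgeSet he
      refine (Finset.card_le_card (t := {{z | G.ReachVia (E(G) \ X) u z},
        {z | G.ReachVia (E(G) \ X) v z}}) ?_).trans Finset.card_le_two
      intro A hA
      obtain ⟨hA, a, b, hab, ha, -⟩ := Finset.mem_filter.1 hA
      obtain ⟨x, -, rfl⟩ := Set.mem_toFinset.1 hA
      have hxa := setOf_reachVia_eq (show G.ReachVia (E(G) \ X) x a from ha)
      obtain ⟨rfl, rfl⟩ | ⟨rfl, rfl⟩ := hab.eq_and_eq_or_eq_and_eq huv <;> simp [hxa]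
    · rw [Finset.card_eq_zero.2]
      · simp
      · refine Finset.filter_eq_empty_iff.2 fun A _ ⟨a, b, hab, _⟩ => he hab.edge_mem

/-- The covering condition for three cobases. As `I` is a basis of `X` in the dual matroid, no edge
of `X \ I` is spanned by the edges outside of `X` and the rest of `X \ I`. -/
theorem IsEdgeConnected.ncard_le_three_mul [Finite α] [Finite β] (hG : G.IsEdgeConnected 3)
    {I : Set β} (hI : G.cographicMatroid.IsBasis I X) : X.ncard ≤ 3 * I.ncard := by
  have hXE : X ⊆ E(G) := hI.subset_ground
  have hcard : (X \ I).ncard + I.ncard = X.ncard :=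
    Set.ncard_sdiff_add_ncard_of_subset hI.subset (Set.toFinite _)
  have hD : ∀ d ∈ X \ I, d ∉ G.edgeSpan ((E(G) \ X) ∪ (X \ I) \ {d}) := by
    intro d hd hsp
    have hIind := cographicMatroid_indep_iff.1 hI.indep
    have hset : (E(G) \ X) ∪ (X \ I) \ {d} = E(G) \ insert d I := by
      ext e
      have := @hXE e
      have : e ∈ I → e ∈ X := fun h => hI.subset h
      have : e = d → e ∈ X := fun h => h ▸ hd.1
      simp only [Set.mem_union, Set.mem_sdiff, Set.mem_insert_iff, Set.mem_singleton_iff] at *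
      tauto
    rw [hset] at hsp
    have hins : G.cographicMatroid.Indep (insert d I) := by
      refine cographicMatroid_indep_iff.2 ⟨Set.insert_subset (hXE hd.1) hIind.1,
        Set.insert_subset hsp (hIind.2.trans (edgeSpan_trans fun e he => ?_))⟩
      by_cases hed : e = d
      · exact hed ▸ hsp
      · exact mem_edgeSpan_of_mem ⟨he.1, by simpa [hed] using he.2⟩ he.1
    exact hd.2 (hI.mem_of_insert_indep hd.1 hins)
  have hle := ncard_add_ncard_walkClasses_le (Set.sdiff_subset.trans hXE) hD
  have hpos : ∀ F, 0 < (G.walkClasses F).ncard := fun F =>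
    (Set.ncard_pos (Set.toFinite _)).2 ((hG.isConnected (by norm_num)).1.image _)
  by_cases hne : (G.walkClasses (E(G) \ X)).Nontrivial
  · have := hG.three_mul_ncard_walkClasses_le hne
    omega
  · rw [Set.not_nontrivial_iff] at hne
    have := Set.ncard_le_one_iff_subsingleton.2 hne
    have := hpos ((E(G) \ X) ∪ (X \ I))
    omega

theorem IsEdgeConnected.exists_isCobaseCover [Finite α] [Finite β] (hG : G.IsEdgeConnected 3) :
    ∃ B : Fin 3 → Set β, MatroidSecretary.IsCobaseCover G B :=
  Matroid.exists_isBase_iUnion_eq fun _ _ hI => by simpa using hG.ncard_le_three_mul hI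

theorem IsConnected.isSpanningTree_iff [Finite β] (hG : G.IsConnected) {T : Set β} :
    G.IsSpanningTree T ↔ G.cycleMatroid.IsBase T := by
  rw [Matroid.isBase_iff_indep_closure_eq, cycleMatroid_indep_iff]
  refine and_congr_right fun hT => ?_
  rw [cycleMatroid_closure hT.1, cycleMatroid_ground]
  constructor
  · refine fun h => edgeSpan_subset.antisymm fun e he => ?_
    obtain ⟨x, y, hl⟩ := G.exists_isLink_of_mem_edgeSet he
    exact ⟨x, y, hl, h x hl.left_mem y hl.right_mem⟩
  · exact fun h x hx y hy => (hG.2 x hx y hy).of_subset_edgeSpan fun e he _ => h.ge he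

theorem IsEdgeConnected.exists_isSpanningTree [Finite α] [Finite β] (hG : G.IsEdgeConnected 3) :
    ∃ T : Fin 3 → Set β, (∀ i, G.IsSpanningTree (T i)) ∧ (⋃ i, E(G) \ T i) = E(G) := by
  obtain ⟨B, hB, hBE⟩ := hG.exists_isCobaseCover
  refine ⟨fun i => E(G) \ B i, fun i => ?_, ?_⟩
  · exact (hG.isConnected (by norm_num)).isSpanningTree_iff.2 (hB i).compl_isBase_of_dual
  · refine (Set.iUnion_congr fun i => ?_).trans hBE
    exact Set.sdiff_sdiff_cancel_left (hB i).subset_ground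

end Graph

/-! ### The secretary problem -/

namespace MatroidSecretary

section Counting

variable {ι K : Type*} [LinearOrder K] {k : ℕ}

/-- The secretary rule with a sample of size `m` selects the best element if the elements arrive
in the order `L`: the best element comes after the sample, and the best of the elements that
precede it, if there is any, is in the sample. -/
def SecretarySuccess (key : ι → K) (m : ℕ) (L : Fin k ≃ ι) : Prop :=
  ∃ t : Fin k, (∀ r, key (L r) ≤ key (L t)) ∧ m ≤ t ∧
    ∀ s < t, (∀ r < t, key (L r) ≤ key (L s)) → (s : ℕ) < m

/-- In a random order, the best of the elements at a set `S` of positions is equally likely to be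
at each of them, even if one conditions on an event `Q` that is invariant under permutations of
these positions. -/
theorem card_mul_ncard_argmax [Finite ι] {key : ι → K} (hkey : Function.Injective key)
    {S : Finset (Fin k)} {Q : (Fin k ≃ ι) → Prop}
    (hQ : ∀ a ∈ S, ∀ b ∈ S, ∀ L, Q L → Q ((Equiv.swap a b).trans L)) {j : Fin k} (hj : j ∈ S) :
    S.card * {L | Q L ∧ ∀ r ∈ S, key (L r) ≤ key (L j)}.ncard = {L | Q L}.ncard := by
  classical
  have := Fintype.ofFinite ι
  let B : Fin k → Finset (Fin k ≃ ι) := fun j =>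
    Finset.univ.filter fun L => Q L ∧ ∀ r ∈ S, key (L r) ≤ key (L j)
  have hB : ∀ j' ∈ S, (B j').card = (B j).card := by
    intro j' hj'
    have hmem : ∀ a ∈ S, ∀ b ∈ S, ∀ L ∈ B a, (Equiv.swap a b).trans L ∈ B b := by
      intro a ha b hb L hL
      simp only [B, Finset.mem_filter, Finset.mem_univ, true_and, Equiv.trans_apply,
        Equiv.swap_apply_right] at hL ⊢
      refine ⟨hQ a ha b hb L hL.1, fun r hr => hL.2 _ ?_⟩
      rw [Equiv.swap_apply_def]
      split_ifs <;> assumption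
    refine Finset.card_nbij' (fun L => (Equiv.swap j' j).trans L)
      (fun L => (Equiv.swap j j').trans L) (hmem j' hj' j hj) (hmem j hj j' hj') ?_ ?_
    · intro L _
      ext r
      simp [Equiv.swap_comm j j']
    · intro L _
      ext r
      simp [Equiv.swap_comm j j']
  have hunion : Finset.univ.filter Q = S.biUnion B := by
    ext L
    simp only [B, Finset.mem_filter, Finset.mem_univ, true_and, Finset.mem_biUnion]
    constructor
    · intro hL
      obtain ⟨a, ha, hmax⟩ := S.exists_max_image (fun r => key (L r)) ⟨j, hj⟩
      exact ⟨a, ha, hL, hmax⟩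
    · rintro ⟨a, -, hL, -⟩
      exact hL
  have hdisj : (S : Set (Fin k)).PairwiseDisjoint B := by
    intro a ha b hb hab
    refine Finset.disjoint_left.2 fun L hLa hLb => hab ?_
    simp only [B, Finset.mem_filter, Finset.mem_univ, true_and] at hLa hLb
    exact L.injective (hkey ((hLb.2 a ha).antisymm (hLa.2 b hb)))
  have hcard := congrArg Finset.card hunion
  rw [Finset.card_biUnion hdisj, Finset.sum_congr rfl hB, Finset.sum_const, smul_eq_mul] at hcard
  have e1 : {L | Q L ∧ ∀ r ∈ S, key (L r) ≤ key (L j)}.ncard = (B j).card := by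
    rw [← Set.ncard_coe_finset]
    congr 1
    ext L
    simp [B]
  have e2 : {L | Q L}.ncard = (Finset.univ.filter Q).card := by
    rw [← Set.ncard_coe_finset]
    congr 1
    ext L
    simp
  rw [e1, e2, hcard]

variable [Finite ι] {key : ι → K}

theorem mul_ncard_best_at (hkey : Function.Injective key) (t : Fin k) :
    k * {L : Fin k ≃ ι | ∀ r, key (L r) ≤ key (L t)}.ncard = Nat.card (Fin k ≃ ι) := by
  have := card_mul_ncard_argmax hkey (S := Finset.univ) (Q := fun _ => True)
    (fun _ _ _ _ _ _ => trivial) (Finset.mem_univ t)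
  simpa [Set.ncard_univ] using this

/-- The best element is at position `t` and the best of the preceding ones is at position `j`
with probability `1 / (k t)`. -/
theorem mul_ncard_best_at_second_at (hkey : Function.Injective key) {t j : Fin k}
    (hjt : j < t) :
    k * (t * {L : Fin k ≃ ι | (∀ r, key (L r) ≤ key (L t)) ∧
      ∀ r < t, key (L r) ≤ key (L j)}.ncard) = Nat.card (Fin k ≃ ι) := by
  have h := card_mul_ncard_argmax hkey (S := Finset.Iio t)
    (Q := fun L : Fin k ≃ ι => ∀ r, key (L r) ≤ key (L t)) (fun a ha b hb L hL r => ?_)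
    (Finset.mem_Iio.2 hjt)
  · simp only [Finset.mem_Iio, Fin.card_Iio] at h
    rw [h, mul_ncard_best_at hkey]
  · rw [Finset.mem_Iio] at ha hb
    rw [Equiv.trans_apply, Equiv.trans_apply, Equiv.swap_apply_of_ne_of_ne ha.ne' hb.ne']
    exact hL _

theorem sum_le_ncard_secretarySuccess (hkey : Function.Injective key) {m : ℕ}
    (hmk : m ≤ k) :
    (Nat.card (Fin k ≃ ι) : ℝ) * (m / k * ∑ t ∈ Finset.Ico m k, (1 / t : ℝ)) ≤
      {L : Fin k ≃ ι | SecretarySuccess key m L}.ncard := by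
  classical
  have := Fintype.ofFinite ι
  let A : Fin k × Fin k → Finset (Fin k ≃ ι) := fun q => Finset.univ.filter fun L =>
    (∀ r, key (L r) ≤ key (L q.1)) ∧ ∀ r < q.1, key (L r) ≤ key (L q.2)
  let I : Finset (Fin k × Fin k) :=
    (Finset.univ.filter fun t : Fin k => m ≤ t) ×ˢ (Finset.univ.filter fun j : Fin k => j < m)
  have hI : ∀ q ∈ I, m ≤ q.1 ∧ q.2 < m ∧ q.2 < q.1 := by
    intro q hq
    simp only [I, Finset.mem_product, Finset.mem_filter, Finset.mem_univ, true_and] at hq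
    exact ⟨hq.1, hq.2, Fin.lt_def.2 (by omega)⟩
  have hdisj : (I : Set (Fin k × Fin k)).PairwiseDisjoint A := by
    rintro ⟨t, j⟩ hq ⟨t', j'⟩ hq' hne
    refine Finset.disjoint_left.2 fun L hL hL' => hne ?_
    simp only [A, Finset.mem_filter, Finset.mem_univ, true_and] at hL hL'
    obtain rfl : t = t' := L.injective (hkey ((hL'.1 t).antisymm (hL.1 t')))
    have h1 := (hI _ hq).2.2
    have h2 := (hI _ hq').2.2
    rw [L.injective (hkey ((hL'.2 j h1).antisymm (hL.2 j' h2)))]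
  have hsub : ((I.biUnion A : Finset (Fin k ≃ ι)) : Set (Fin k ≃ ι)) ⊆
      {L | SecretarySuccess key m L} := by
    intro L hL
    rw [Finset.mem_coe, Finset.mem_biUnion] at hL
    obtain ⟨⟨t, j⟩, hq, hL⟩ := hL
    simp only [A, Finset.mem_filter, Finset.mem_univ, true_and] at hL
    obtain ⟨hmt, hjm, hjt⟩ := hI _ hq
    refine ⟨t, hL.1, hmt, fun s hs hmax => ?_⟩
    rwa [L.injective (hkey ((hL.2 s hs).antisymm (hmax j hjt)))]
  have hcard : ∀ q ∈ I, ((A q).card : ℝ) = (Nat.card (Fin k ≃ ι) : ℝ) / k * (1 / (q.1 : ℕ)) := by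
    intro q hq
    obtain ⟨hmt, hjm, hjt⟩ := hI q hq
    have h := mul_ncard_best_at_second_at hkey hjt
    have e1 : {L : Fin k ≃ ι | (∀ r, key (L r) ≤ key (L q.1)) ∧
        ∀ r < q.1, key (L r) ≤ key (L q.2)}.ncard = (A q).card := by
      rw [← Set.ncard_coe_finset]
      congr 1
      ext L
      simp [A]
    rw [e1] at h
    have hk : (k : ℝ) ≠ 0 := by
      have : 0 < k := by omega
      positivity
    have ht : ((q.1 : ℕ) : ℝ) ≠ 0 := by
      have : 0 < (q.1 : ℕ) := by omega
      positivity
    have h' : (k : ℝ) * ((q.1 : ℕ) * (A q).card) = Nat.card (Fin k ≃ ι) := by exact_mod_cast h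
    field_simp
    linarith
  have h1 : (((I.biUnion A).card : ℕ) : ℝ) ≤ {L : Fin k ≃ ι | SecretarySuccess key m L}.ncard := by
    rw [← Set.ncard_coe_finset]
    exact_mod_cast Set.ncard_le_ncard hsub (Set.toFinite _)
  refine le_trans (le_of_eq ?_) h1
  rw [Finset.card_biUnion hdisj, Nat.cast_sum, Finset.sum_congr rfl hcard, ← Finset.mul_sum,
    Finset.sum_product]
  simp only [Finset.sum_const, nsmul_eq_mul]
  have hm' : (Finset.univ.filter fun j : Fin k => (j : ℕ) < m).card = m := by
    rw [Fin.card_filter_val_lt, min_eq_right hmk]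
  have hs : ∑ t ∈ Finset.univ.filter (fun t : Fin k => m ≤ t), (1 / (t : ℕ) : ℝ) =
      ∑ t ∈ Finset.Ico m k, (1 / t : ℝ) := by
    refine Finset.sum_bij (fun t _ => (t : ℕ)) ?_ ?_ ?_ ?_
    · intro t ht
      simp at ht
      simp [ht]
    · intro a _ b _ hab
      exact Fin.ext hab
    · intro b hb
      rw [Finset.mem_Ico] at hb
      exact ⟨⟨b, hb.2⟩, by simpa using hb.1, rfl⟩
    · intros; rfl
  rw [hm', ← Finset.mul_sum, hs]
  ring

end Counting

section Analysis

open Real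

theorem log_succ_sub_log_le {t : ℝ} (ht : 0 < t) :
    log (t + 1) - log t ≤ (1 / t + 1 / (t + 1)) / 2 := by
  have hy : 0 < (t + 1) / t := by positivity
  have h0 : 0 ≤ log ((t + 1) / t) := log_nonneg (by rw [le_div_iff₀ ht]; linarith)
  -- this is `x ≤ sinh x` for `x = log ((t + 1) / t)`
  have h := self_le_sinh_iff.2 h0
  rw [sinh_eq, exp_neg, exp_log hy, log_div (by positivity) ht.ne'] at h
  refine h.trans (le_of_eq ?_)
  field_simp
  ring

/-- The trapezoid rule overestimates the integral of `1 / x`. -/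
theorem log_add_le_sum_Ico {m k : ℕ} (hm : 0 < m) (hmk : m ≤ k) :
    log k - log m + (1 / m - 1 / k) / 2 ≤ ∑ t ∈ Finset.Ico m k, (1 / t : ℝ) := by
  induction k, hmk using Nat.le_induction with
  | base => simp
  | succ k hmk ih =>
    have h := log_succ_sub_log_le (t := k) (by exact_mod_cast hm.trans_le hmk)
    rw [Finset.sum_Ico_succ_top hmk]
    push_cast
    linarith

/-- The success probability of the secretary rule is at least `1 / e` for each number `k` of
elements for which the sample is not empty. -/
theorem le_exp_one_mul_sum_Ico {k m : ℕ} (hm : ⌊(k : ℝ) / exp 1⌋₊ = m) (hm0 : 0 < m) :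
    (k : ℝ) ≤ exp 1 * (m * ∑ t ∈ Finset.Ico m k, (1 / t : ℝ)) := by
  have he1 := exp_one_gt_d9
  have he2 := exp_one_lt_d9
  have he0 : 0 < exp 1 := exp_pos 1
  have hfl := Nat.floor_le (a := (k : ℝ) / exp 1) (by positivity)
  have hlt := Nat.lt_floor_add_one ((k : ℝ) / exp 1)
  rw [hm] at hfl hlt
  rw [le_div_iff₀ he0] at hfl
  rw [div_lt_iff₀ he0] at hlt
  have hmpos : (0 : ℝ) < m := by exact_mod_cast hm0
  obtain rfl | hm2 : m = 1 ∨ 2 ≤ m := by omega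
  · -- the estimate below needs `2 ≤ m`; here `k` is `3`, `4` or `5`
    have hk3 : 2 < k := by
      have : (2 : ℝ) < k := by push_cast at hfl; linarith
      exact_mod_cast this
    have hk5 : k < 6 := by
      have : (k : ℝ) < 6 := by push_cast at hlt; linarith
      exact_mod_cast this
    interval_cases k <;> norm_num [Finset.sum_Ico_succ_top] <;> linarith
  have hkpos : (0 : ℝ) < k := by nlinarith
  have hmk : m ≤ k := by
    have : (m : ℝ) ≤ k := by nlinarith
    exact_mod_cast this
  have hsum := log_add_le_sum_Ico hm0 hmk
  -- write `k = e m (1 + u)` with `0 ≤ u < 1 / m`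
  obtain ⟨u, hu⟩ : ∃ u : ℝ, (k : ℝ) = exp 1 * m * (1 + u) :=
    ⟨k / (exp 1 * m) - 1, by field_simp; ring⟩
  have hem : 0 < exp 1 * m := by positivity
  have hu0 : 0 ≤ u := by
    by_contra! h
    nlinarith
  have hu1 : m * u < 1 := by
    by_contra! h
    nlinarith
  have hlog : log k - log m = 1 + log (1 + u) := by
    rw [hu, log_mul hem.ne' (by positivity), log_mul he0.ne' hmpos.ne', log_exp]
    ring
  have hlogu : u - u ^ 2 / 2 ≤ log (1 + u) := by
    refine le_trans ?_ (le_log_one_add_of_nonneg hu0)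
    rw [le_div_iff₀ (by positivity)]
    nlinarith [pow_nonneg hu0 3]
  have hmk2 : 1 / (k : ℝ) ≤ 1 / m / 2 := by
    rw [div_div]
    exact one_div_le_one_div_of_le (by positivity) (by nlinarith)
  have hu2 : u ^ 2 / 2 ≤ 1 / m / 4 := by
    rw [div_div, le_div_iff₀ (by positivity)]
    have hm2' : (2 : ℝ) ≤ m := by exact_mod_cast hm2
    have : m * u ^ 2 * 2 ≤ 1 := by nlinarith [mul_nonneg hmpos.le hu0]
    linarith
  have hle : 1 + u ≤ ∑ t ∈ Finset.Ico m k, (1 / t : ℝ) := by linarith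
  calc (k : ℝ) = exp 1 * (m * (1 + u)) := by rw [hu]; ring
    _ ≤ _ := by gcongr

end Analysis

/-- The classical bound for the secretary rule: it selects the best element with probability at
least `1 / e`. -/
theorem card_le_exp_one_mul_ncard_secretarySuccess {ι K : Type*} [Finite ι] [LinearOrder K]
    {k : ℕ} {key : ι → K} (hkey : Function.Injective key) (hk : 0 < k) :
    (Nat.card (Fin k ≃ ι) : ℝ) ≤ Real.exp 1 *
      {L : Fin k ≃ ι | SecretarySuccess key ⌊(k : ℝ) / Real.exp 1⌋₊ L}.ncard := by
  obtain ⟨m, hm⟩ : ∃ m, ⌊(k : ℝ) / Real.exp 1⌋₊ = m := ⟨_, rfl⟩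
  have hk' : (0 : ℝ) < k := by exact_mod_cast hk
  have he0 := Real.exp_pos 1
  rw [hm]
  obtain rfl | hm0 := Nat.eq_zero_or_pos m
  · -- with an empty sample, the rule succeeds if the first element is the best one
    have hke : (k : ℝ) ≤ Real.exp 1 := by
      rw [Nat.floor_eq_zero, div_lt_one he0] at hm
      exact hm.le
    have hsub : {L : Fin k ≃ ι | ∀ r, key (L r) ≤ key (L ⟨0, hk⟩)} ⊆
        {L | SecretarySuccess key 0 L} := fun L hL =>
      ⟨⟨0, hk⟩, hL, Nat.zero_le _, fun s hs => (Nat.not_lt_zero _ (Fin.lt_def.1 hs)).elim⟩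
    have hle : ({L : Fin k ≃ ι | ∀ r, key (L r) ≤ key (L ⟨0, hk⟩)}.ncard : ℝ) ≤
        {L : Fin k ≃ ι | SecretarySuccess key 0 L}.ncard := by
      exact_mod_cast Set.ncard_le_ncard hsub (Set.toFinite _)
    have h : (k : ℝ) * {L : Fin k ≃ ι | ∀ r, key (L r) ≤ key (L ⟨0, hk⟩)}.ncard =
        Nat.card (Fin k ≃ ι) := by exact_mod_cast mul_ncard_best_at hkey ⟨0, hk⟩
    rw [← h]
    gcongr
  · have hmk : m ≤ k := by
      rw [← hm]
      refine Nat.floor_le_of_le (div_le_self hk'.le ?_)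
      exact Real.one_le_exp zero_le_one
    have h1 := sum_le_ncard_secretarySuccess hkey hmk
    have h2 := le_exp_one_mul_sum_Ico hm hm0
    refine le_trans ?_ (mul_le_mul_of_nonneg_left h1 he0.le)
    have h3 : 1 ≤ Real.exp 1 * (m / k * ∑ t ∈ Finset.Ico m k, (1 / t : ℝ)) := by
      have h4 : Real.exp 1 * (m / k * ∑ t ∈ Finset.Ico m k, (1 / t : ℝ)) =
          Real.exp 1 * (m * ∑ t ∈ Finset.Ico m k, (1 / t : ℝ)) / k := by ring
      rwa [h4, le_div_iff₀ hk', one_mul]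
    nlinarith [Nat.cast_nonneg (α := ℝ) (Nat.card (Fin k ≃ ι))]

/-- Orders of arrival of all elements induce uniformly random orders of a subset `P`, since the
permutations of `P` act on them. -/
theorem card_le_mul_ncard_restrict {E : Type*} [Finite E] {n k : ℕ} {P : Set E}
    (hk : Nat.card P = k) (T : (Fin k ≃ P) → Prop) {q : ℝ}
    (hT : (Nat.card (Fin k ≃ P) : ℝ) ≤ q * {L | T L}.ncard) :
    (Nat.card (Fin n ≃ E) : ℝ) ≤
      q * {π : Fin n ≃ E | ∃ L : Fin k ≃ P, StrictMono (fun t => π.symm (L t)) ∧ T L}.ncard := by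
  classical
  have := Fintype.ofFinite E
  let Good : (Fin n ≃ E) → Prop := fun π =>
    ∃ L : Fin k ≃ P, StrictMono (fun t => π.symm (L t)) ∧ T L
  have hex : ∀ π : Fin n ≃ E, ∃ L : Fin k ≃ P, StrictMono fun t => π.symm (L t) := by
    intro π
    let S : Finset (Fin n) := Finset.univ.filter fun i => π i ∈ P
    have e : S ≃ P := (π.subtypeEquiv fun i => by simp [S])
    have hS : S.card = k := by rw [← hk, ← Nat.card_congr e]; simp
    let o := S.orderIsoOfFin hS
    refine ⟨o.toEquiv.trans (π.subtypeEquiv fun i => by simp [S]), fun s t hst => ?_⟩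
    simpa using hst
  choose L hL using hex
  have hshift : ∀ π : Fin n ≃ E, ∀ σ : Equiv.Perm P, T ((L π).trans σ) →
      Good (π.trans (Equiv.Perm.ofSubtype σ)) := by
    intro π σ h
    refine ⟨(L π).trans σ, ?_, h⟩
    have : (fun t => (π.trans (Equiv.Perm.ofSubtype σ)).symm (((L π).trans σ) t : P)) =
        fun t => π.symm (L π t) := by
      funext t
      rw [Equiv.symm_apply_eq]
      simp
    rw [this]
    exact hL π
  -- double counting of the pairs of an order and a permutation of `P` that lead to success
  have hcount : Fintype.card (Fin n ≃ E) * {L | T L}.ncard ≤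
      Fintype.card (Equiv.Perm P) * {π | Good π}.ncard := by
    have h1 : ∀ π : Fin n ≃ E, {L | T L}.ncard = {σ : Equiv.Perm P | T ((L π).trans σ)}.ncard := by
      intro π
      refine (Set.ncard_congr (fun σ _ => (L π).trans σ) (fun σ h => h) ?_ ?_).symm
      · intro σ σ' _ _ h
        ext x
        have := congrArg (fun e => e ((L π).symm x)) h
        simpa using congrArg Subtype.val this
      · intro L' hL'
        refine ⟨(L π).symm.trans L', ?_, ?_⟩
        · have : (L π).trans ((L π).symm.trans L') = L' := by ext; simp
          change T ((L π).trans ((L π).symm.trans L'))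
          rwa [this]
        · ext; simp
    have h2 : ∀ σ : Equiv.Perm P, {π : Fin n ≃ E | Good (π.trans (Equiv.Perm.ofSubtype σ))}.ncard =
        {π | Good π}.ncard := by
      intro σ
      refine Set.ncard_congr (fun π _ => π.trans (Equiv.Perm.ofSubtype σ)) (fun π h => h) ?_ ?_
      · intro π π' _ _ h
        ext x
        have := congrArg (fun e => e x) h
        simpa using this
      · intro π hπ
        refine ⟨π.trans (Equiv.Perm.ofSubtype σ).symm, ?_, ?_⟩
        · have : (π.trans (Equiv.Perm.ofSubtype σ).symm).trans (Equiv.Perm.ofSubtype σ) = π := by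
            ext; simp
          change Good _
          rwa [this]
        · ext; simp
    calc Fintype.card (Fin n ≃ E) * {L | T L}.ncard
        = ∑ π : Fin n ≃ E, {σ : Equiv.Perm P | T ((L π).trans σ)}.ncard := by
          simp [← h1]
      _ ≤ ∑ π : Fin n ≃ E, {σ : Equiv.Perm P | Good (π.trans (Equiv.Perm.ofSubtype σ))}.ncard :=
          Finset.sum_le_sum fun π _ => Set.ncard_le_ncard (fun σ h => hshift π σ h)
            (Set.toFinite _)
      _ = ∑ σ : Equiv.Perm P, {π : Fin n ≃ E | Good (π.trans (Equiv.Perm.ofSubtype σ))}.ncard := by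
          have := Finset.sum_card_bipartiteAbove_eq_sum_card_bipartiteBelow
            (s := (Finset.univ : Finset (Fin n ≃ E)))
            (t := (Finset.univ : Finset (Equiv.Perm P)))
            (fun π σ => Good (π.trans (Equiv.Perm.ofSubtype σ)))
          simpa [Finset.bipartiteAbove, Finset.bipartiteBelow, Set.ncard_eq_toFinset_card'] using
            this
      _ = Fintype.card (Equiv.Perm P) * {π | Good π}.ncard := by simp [h2]
  have hcardP : Nat.card (Fin k ≃ P) = Fintype.card (Equiv.Perm P) := by
    have e : Fin k ≃ P := (Finite.equivFinOfCardEq hk).symm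
    rw [← Nat.card_eq_fintype_card]
    exact Nat.card_congr (Equiv.equivCongr e (Equiv.refl _))
  have hpos : (0 : ℝ) < Fintype.card (Equiv.Perm P) := by
    exact_mod_cast Fintype.card_pos
  rw [hcardP] at hT
  rw [Nat.card_eq_fintype_card]
  have hTpos : (0 : ℝ) < q * {L | T L}.ncard := hpos.trans_le hT
  have hq : 0 < q := by
    by_contra! h
    have : (0 : ℝ) ≤ {L | T L}.ncard := Nat.cast_nonneg _
    nlinarith
  have hcount' : (Fintype.card (Fin n ≃ E) : ℝ) * {L | T L}.ncard ≤
      Fintype.card (Equiv.Perm P) * {π | Good π}.ncard := by exact_mod_cast hcount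
  have h1 : (Fintype.card (Fin n ≃ E) : ℝ) * Fintype.card (Equiv.Perm P) ≤
      Fintype.card (Equiv.Perm P) * (q * {π | Good π}.ncard) := by
    calc (Fintype.card (Fin n ≃ E) : ℝ) * Fintype.card (Equiv.Perm P)
        ≤ Fintype.card (Fin n ≃ E) * (q * {L | T L}.ncard) := by gcongr
      _ = q * (Fintype.card (Fin n ≃ E) * {L | T L}.ncard) := by ring
      _ ≤ q * (Fintype.card (Equiv.Perm P) * {π | Good π}.ncard) := by gcongr
      _ = _ := by ring
  rw [mul_comm] at h1
  exact le_of_mul_le_mul_left h1 hpos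

end MatroidSecretary

/-! ### The secretary rule in the online model -/

namespace MatroidSecretary

open Matroid

variable {β : Type*} {M : Matroid β}

/-- The pair of the weight and the position in `τ`, which represents the order `Heavier w τ` as the
lexicographic order (`heavier_iff`). -/
def weightKey (w : β → ℝ) (τ : Order M) (e : M.E) : ℝ ×ₗ Fin M.E.ncard :=
  toLex (w e, τ.symm e)

theorem weightKey_injective (w : β → ℝ) (τ : Order M) : Function.Injective (weightKey w τ) := by
  intro e f h
  exact τ.symm.injective (congrArg Prod.snd (toLex.injective h))

theorem heavier_iff {w : β → ℝ} {τ : Order M} {e f : M.E} :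
    Heavier w τ e f ↔ weightKey w τ f < weightKey w τ e := by
  rw [weightKey, weightKey, Prod.Lex.toLex_lt_toLex]
  constructor
  · rintro ⟨i, j, hi, hj, h⟩
    obtain rfl : τ i = e := Subtype.ext hi
    obtain rfl : τ j = f := Subtype.ext hj
    simpa using h
  · intro h
    exact ⟨τ.symm e, τ.symm f, by simp, by simp, h⟩

theorem Heavier.mem_ground {w : β → ℝ} {τ : Order M} {e f : β} (h : Heavier w τ e f) :
    e ∈ M.E ∧ f ∈ M.E := by
  obtain ⟨i, j, rfl, rfl, -⟩ := h
  exact ⟨(τ i).2, (τ j).2⟩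

theorem Heavier.asymm {w : β → ℝ} {τ : Order M} {e f : β} (h : Heavier w τ e f) :
    ¬ Heavier w τ f e := by
  obtain ⟨he, hf⟩ := h.mem_ground
  intro h'
  exact lt_asymm (heavier_iff (e := ⟨e, he⟩) (f := ⟨f, hf⟩).1 h)
    (heavier_iff (e := ⟨f, hf⟩) (f := ⟨e, he⟩).1 h')

theorem exists_heaviest [Finite β] (w : β → ℝ) (τ : Order M) {X : Set β} (hX : X ⊆ M.E)
    (hne : X.Nonempty) : ∃ f ∈ X, ∀ g ∈ X, g ≠ f → Heavier w τ f g := by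
  obtain ⟨e, he⟩ := hne
  obtain ⟨f, hf, hmax⟩ := Set.exists_max_image {x : M.E | (x : β) ∈ X} (weightKey w τ)
    (Set.toFinite _) ⟨⟨e, hX he⟩, he⟩
  refine ⟨f, hf, fun g hg hgf => ?_⟩
  refine heavier_iff (f := ⟨g, hX hg⟩).2 (lt_of_le_of_ne (hmax ⟨g, hX hg⟩ hg) fun h => hgf ?_)
  exact congrArg Subtype.val (weightKey_injective w τ h)

/-- If `e` has been selected, then no later element is: the best element seen so far is not in
the sample. -/
theorem SecretaryAccepts.not_of_mem_past [Finite β] {w : β → ℝ} {τ : Order M} {P : Set β}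
    (hP : P ⊆ M.E) {past mid : List β} {e e' : β} (he : e ∈ P)
    (h : SecretaryAccepts P past
      (fun a b => a ∈ past ++ [e] ∧ b ∈ past ++ [e] ∧ Heavier w τ a b) e) :
    ¬ SecretaryAccepts P (past ++ e :: mid) (fun a b => a ∈ (past ++ e :: mid) ++ [e'] ∧
      b ∈ (past ++ e :: mid) ++ [e'] ∧ Heavier w τ a b) e' := by
  classical
  rintro ⟨-, -, h'⟩
  -- the best element `f` seen before `e'` would be in the sample, but `e` is heavier than that
  obtain ⟨hm, hbest, -⟩ := h
  have hemem : e ∈ (past ++ e :: mid).filter (· ∈ P) := List.mem_filter.2 ⟨by simp, by simpa⟩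
  obtain ⟨f, hf, hfmax⟩ := exists_heaviest w τ
    (X := {x | x ∈ (past ++ e :: mid).filter (· ∈ P)})
    (fun x hx => hP (by simpa using (List.mem_filter.1 hx).2)) ⟨e, hemem⟩
  have htake := h' f hf fun g hg hgf =>
    ⟨List.mem_append_left _ (List.mem_filter.1 hf).1,
      List.mem_append_left _ (List.mem_filter.1 hg).1, hfmax g hg hgf⟩
  rw [List.filter_append, List.take_append_of_le_length hm] at htake
  have hef := (hbest f (List.mem_of_mem_take htake)).2.2
  have hne : e ≠ f := by
    rintro rfl
    exact hef.asymm hef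
  exact hef.asymm (hfmax e hemem hne)

theorem SecretaryAccepts.eq [Finite β] {w : β → ℝ} {τ : Order M} {P : Set β} (hP : P ⊆ M.E)
    {past future past' future' : List β} {e e' : β} (he : e ∈ P) (he' : e' ∈ P)
    (heq : past ++ e :: future = past' ++ e' :: future')
    (h : SecretaryAccepts P past
      (fun a b => a ∈ past ++ [e] ∧ b ∈ past ++ [e] ∧ Heavier w τ a b) e)
    (h' : SecretaryAccepts P past'
      (fun a b => a ∈ past' ++ [e'] ∧ b ∈ past' ++ [e'] ∧ Heavier w τ a b) e') : e = e' := by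
  obtain ⟨mid, rfl, hmid⟩ | ⟨mid, rfl, hmid⟩ := List.append_eq_append_iff.1 heq
  · obtain _ | ⟨x, mid⟩ := mid
    · simp at hmid
      exact hmid.1
    · obtain rfl : e = x := by simp at hmid; exact hmid.1
      exact (h.not_of_mem_past hP he h').elim
  · obtain _ | ⟨x, mid⟩ := mid
    · simp at hmid
      exact hmid.1.symm
    · obtain rfl : e' = x := by simp at hmid; exact hmid.1
      exact (h'.not_of_mem_past hP he' h).elim

open Classical in
/-- If the elements of `P` arrive in the order `L`, then those before `L t` are the first `t`
entries of `L`. -/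
theorem filter_take_ofFn_eq {P : Set β} (hP : P ⊆ M.E) (π : Order M) {k : ℕ} (L : Fin k ≃ P)
    (hL : StrictMono fun t => π.symm ⟨L t, hP (L t).2⟩) (t : Fin k) :
    ((List.ofFn fun i => (π i : β)).take (π.symm ⟨L t, hP (L t).2⟩)).filter (· ∈ P) =
      List.ofFn fun s : Fin t => (L (s.castLE t.2.le) : β) := by
  have hinj : Function.Injective fun i => (π i : β) :=
    Subtype.val_injective.comp π.injective
  have hmem : ∀ s : Fin k, (π (π.symm ⟨L s, hP (L s).2⟩) : β) = L s := fun s => by simp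
  let r : β → β → Prop := fun a b => ∃ i j, (π i : β) = a ∧ (π j : β) = b ∧ i < j
  refine List.Perm.eq_of_pairwise (le := r) ?_ ?_ ?_ ?_
  · rintro a b - - ⟨i, j, rfl, rfl, hij⟩ ⟨i', j', hi, hj, hij'⟩
    obtain rfl := hinj hi
    obtain rfl := hinj hj
    exact (lt_asymm hij hij').elim
  · refine List.Pairwise.sublist (List.filter_sublist.trans (List.take_sublist _ _)) ?_
    exact List.pairwise_ofFn.2 fun i j hij => ⟨i, j, rfl, rfl, hij⟩
  · refine List.pairwise_ofFn.2 fun i j hij => ⟨_, _, hmem _, hmem _, hL ?_⟩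
    exact Fin.lt_def.2 hij
  · rw [List.perm_ext_iff_of_nodup]
    · intro a
      rw [List.mem_filter, List.mem_take_iff_getElem, List.mem_ofFn]
      constructor
      · rintro ⟨⟨i, hi, rfl⟩, haP⟩
        simp only [List.getElem_ofFn, decide_eq_true_eq] at haP ⊢
        obtain ⟨s, hs⟩ := L.surjective ⟨_, haP⟩
        have hs' : (L s : β) = _ := congrArg Subtype.val hs
        have hst : s < t := by
          rw [← hL.lt_iff_lt]
          rw [lt_min_iff] at hi
          have : (⟨L s, hP (L s).2⟩ : M.E) = π ⟨i, by simpa using hi.2⟩ := Subtype.ext hs'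
          simp only [this, Equiv.symm_apply_apply]
          exact Fin.lt_def.2 hi.1
        exact ⟨⟨s, hst⟩, hs'⟩
      · rintro ⟨s, rfl⟩
        refine ⟨⟨π.symm ⟨L (s.castLE t.2.le), hP (L _).2⟩, ?_, ?_⟩, by simp⟩
        · rw [lt_min_iff]
          refine ⟨Fin.lt_def.1 (hL ?_), by simp⟩
          exact Fin.lt_def.2 s.2
        · simp
    · exact ((List.nodup_ofFn.2 hinj).sublist (List.take_sublist _ _)).filter _
    · refine List.nodup_ofFn.2 fun a b hab => ?_
      have := L.injective (Subtype.ext hab)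
      exact Fin.castLE_injective _ this

/-- The secretary rule depends on the order in which the elements of `P` arrive, only. -/
theorem SecretarySuccess.exists_accepts {w : β → ℝ} {τ : Order M} {P : Set β} (hP : P ⊆ M.E)
    {π : Order M} {k : ℕ} (hk : P.ncard = k) {L : Fin k ≃ P}
    (hL : StrictMono fun t => π.symm ⟨L t, hP (L t).2⟩)
    (h : SecretarySuccess (fun e : P => weightKey w τ ⟨e, hP e.2⟩) ⌊(k : ℝ) / Real.exp 1⌋₊ L) :
    ∃ b ∈ P, (∀ e ∈ P, w e ≤ w b) ∧
      ∃ past future, (List.ofFn fun i => (π i : β)) = past ++ b :: future ∧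
        SecretaryAccepts P past
          (fun x y => x ∈ past ++ [b] ∧ y ∈ past ++ [b] ∧ Heavier w τ x y) b := by
  classical
  obtain ⟨t, hbest, hmt, hsample⟩ := h
  have hinj : ∀ s s' : Fin k, weightKey w τ ⟨L s, hP (L s).2⟩ = weightKey w τ ⟨L s', hP (L s').2⟩ →
      s = s' := fun s s' h => L.injective (Subtype.ext
        (congrArg (fun x : M.E => (x : β)) (weightKey_injective w τ h)))
  obtain ⟨p, hp⟩ : ∃ p, π.symm ⟨L t, hP (L t).2⟩ = p := ⟨_, rfl⟩
  refine ⟨L t, (L t).2, fun e he => ?_, (List.ofFn fun i => (π i : β)).take p,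
    (List.ofFn fun i => (π i : β)).drop (p + 1), ?_, ?_⟩
  · obtain ⟨r, hr⟩ := L.surjective ⟨e, he⟩
    have h1 := hbest r
    simp only [weightKey, Prod.Lex.toLex_le_toLex, hr] at h1
    obtain h1 | h1 := h1
    · exact h1.le
    · exact h1.1.le
  · have hlen : (p : ℕ) < (List.ofFn fun i => (π i : β)).length := by simp
    have hget : (List.ofFn fun i => (π i : β))[(p : ℕ)] = L t := by simp [← hp]
    rw [← hget, List.getElem_cons_drop, List.take_append_drop]
  · have hseen := filter_take_ofFn_eq hP π L hL t
    rw [hp] at hseen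
    have hpast : ∀ s : Fin k, s < t →
        (L s : β) ∈ (List.ofFn fun i => (π i : β)).take p := by
      intro s hs
      have : (L s : β) ∈ ((List.ofFn fun i => (π i : β)).take p).filter (· ∈ P) := by
        rw [hseen, List.mem_ofFn]
        exact ⟨⟨s, hs⟩, rfl⟩
      exact (List.mem_filter.1 this).1
    rw [SecretaryAccepts, hk, hseen]
    refine ⟨by simpa using hmt, ?_, ?_⟩
    · intro f hf
      obtain ⟨s, rfl⟩ := List.mem_ofFn.1 hf
      have hst : s.castLE t.2.le < t := Fin.lt_def.2 s.2
      refine ⟨by simp, List.mem_append_left _ (hpast _ hst), ?_⟩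
      refine heavier_iff (M := M) (e := ⟨L t, hP (L t).2⟩)
        (f := ⟨L (s.castLE t.2.le), hP (L _).2⟩).2 ?_
      exact lt_of_le_of_ne (hbest _) fun h => hst.ne (hinj _ _ h)
    · intro f hf hmax
      obtain ⟨s, rfl⟩ := List.mem_ofFn.1 hf
      have hst : s.castLE t.2.le < t := Fin.lt_def.2 s.2
      have hsm := hsample _ hst fun r hr => by
        by_cases hrs : r = s.castLE t.2.le
        · rw [hrs]
        · have hr' := hmax (L r) (List.mem_ofFn.2 ⟨⟨r, hr⟩, rfl⟩)
            fun h => hrs (L.injective (Subtype.ext h))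
          exact (heavier_iff (M := M) (e := ⟨L (s.castLE t.2.le), hP (L _).2⟩)
            (f := ⟨L r, hP (L r).2⟩).1 hr'.2.2).le
      rw [List.mem_take_iff_getElem]
      exact ⟨s, by simpa using hsm, by simp⟩

/-! ### Competitiveness -/

theorem card_prod_le {S Y : Type*} [Finite S] [Finite Y] {S' : Set S} {Y' : Set Y} {a b : ℝ}
    (hS : (Nat.card S : ℝ) ≤ a * S'.ncard) (hY : (Nat.card Y : ℝ) ≤ b * Y'.ncard) :
    (Nat.card (S × Y) : ℝ) ≤ a * b * (S' ×ˢ Y').ncard := by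
  rw [Nat.card_prod, Set.ncard_prod]
  push_cast
  calc (Nat.card S : ℝ) * Nat.card Y ≤ (a * S'.ncard) * (b * Y'.ncard) := by
        refine mul_le_mul hS hY (Nat.cast_nonneg _) ((Nat.cast_nonneg _).trans hS)
    _ = _ := by ring

theorem card_prod_le_of_forall {O T : Type*} [Finite O] [Finite T] {Y : T → Set O} {q : ℝ}
    (h : ∀ t, (Nat.card O : ℝ) ≤ q * (Y t).ncard) :
    (Nat.card (O × T) : ℝ) ≤ q * {p : O × T | p.1 ∈ Y p.2}.ncard := by
  have := Fintype.ofFinite T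
  have hcard : {p : O × T | p.1 ∈ Y p.2}.ncard = ∑ t, (Y t).ncard := by
    let φ : {p : O × T | p.1 ∈ Y p.2} ≃ Σ t, Y t :=
      { toFun := fun p => ⟨p.1.2, p.1.1, p.2⟩
        invFun := fun p => ⟨(p.2.1, p.1), p.2.2⟩
        left_inv := fun _ => rfl
        right_inv := fun _ => rfl }
    rw [← Nat.card_coe_set_eq, Nat.card_congr φ, Nat.card_sigma]
    simp only [Nat.card_coe_set_eq]
  rw [hcard, Nat.card_prod, Nat.cast_mul, Nat.cast_sum, Finset.mul_sum, mul_comm,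
    Nat.card_eq_fintype_card (α := T), ← nsmul_eq_mul]
  exact Finset.card_nsmul_le_sum _ _ _ fun t _ => h t

/-- A uniformly random index family takes any given value at a given place with probability
`1 / 3`. -/
theorem card_le_three_mul_ncard_eval_eq {κ : Type*} [Finite κ] (C : κ) (j : Fin 3) :
    (Nat.card (κ → Fin 3) : ℝ) ≤ 3 * {s : κ → Fin 3 | s C = j}.ncard := by
  classical
  have hinj : Function.Injective (fun s : κ → Fin 3 =>
      ((s C, ⟨Function.update s C j, by simp⟩) : Fin 3 × {s : κ → Fin 3 | s C = j})) := by
    intro s s' h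
    simp only [Prod.mk.injEq, Subtype.mk.injEq] at h
    ext x
    by_cases hx : x = C
    · rw [hx, h.1]
    · have := congrFun h.2 x
      rw [Function.update_of_ne hx, Function.update_of_ne hx] at this
      rw [this]
  have := Nat.card_le_card_of_injective _ hinj
  rw [Nat.card_prod, Nat.card_fin, Nat.card_coe_set_eq] at this
  exact_mod_cast this

/-- An algorithm is `c`-competitive if for each element `e` that is not a loop, it accepts with
probability at least `1 / c` an element parallel to `e` that is not lighter. Indeed, the elements
of an independent set lie in different parallel classes. -/
theorem OnlineAlgorithm.isCompetitive_of_inParallel [Finite β] {A : OnlineAlgorithm β} {c : ℝ}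
    (hc : 0 ≤ c) (hind : ∀ w s π τ, M.Indep (A.output M w s π τ))
    (h : ∀ (w : β → ℝ) (e : β), M.IsNonloop e → (Nat.card (A.Seed × Order M × Order M) : ℝ) ≤
      c * {ω : A.Seed × Order M × Order M | ∃ b ∈ A.output M w ω.1 ω.2.1 ω.2.2,
        M.InParallel e b ∧ w e ≤ w b}.ncard) : A.IsCompetitive M c := by
  classical
  refine fun w hw => ⟨hind w, fun I hI => ?_⟩
  have := A.finite_seed
  have := A.nonempty_seed
  have hO : Nonempty (Order M) := ⟨(Finite.equivFinOfCardEq (Nat.card_coe_set_eq M.E)).symm⟩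
  have := Fintype.ofFinite β
  have := Fintype.ofFinite (A.Seed × Order M × Order M)
  let out : A.Seed × Order M × Order M → Set β := fun ω => A.output M w ω.1 ω.2.1 ω.2.2
  let Hit : β → Set (A.Seed × Order M × Order M) := fun e =>
    {ω | ∃ b ∈ out ω, M.InParallel e b ∧ w e ≤ w b}
  have hwI : ∀ e ∈ I.toFinset, 0 ≤ w e := fun e he =>
    hw e (hI.subset_ground (Set.mem_toFinset.1 he))
  have hpoint : ∀ ω, ∑ e ∈ I.toFinset, (if ω ∈ Hit e then w e else 0) ≤ ∑ᶠ e ∈ out ω, w e := by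
    intro ω
    rw [← Finset.sum_filter, finsum_mem_eq_toFinset_sum]
    have hmem : ∀ e ∈ I.toFinset.filter (fun e => ω ∈ Hit e),
        ∃ b ∈ out ω, M.InParallel e b ∧ w e ≤ w b := fun e he => (Finset.mem_filter.1 he).2
    choose! φ hφ using hmem
    calc ∑ e ∈ I.toFinset.filter (fun e => ω ∈ Hit e), w e
        ≤ ∑ e ∈ I.toFinset.filter (fun e => ω ∈ Hit e), w (φ e) :=
          Finset.sum_le_sum fun e he => (hφ e he).2.2
      _ = ∑ b ∈ (I.toFinset.filter (fun e => ω ∈ Hit e)).image φ, w b := by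
          refine (Finset.sum_image fun e he f hf hef => ?_).symm
          rw [Finset.mem_coe] at he hf
          have hp : M.InParallel e f := (hφ e he).2.1.trans (hef ▸ (hφ f hf).2.1.symm)
          exact hp.eq_of_indep hI (Set.mem_toFinset.1 (Finset.mem_filter.1 he).1)
            (Set.mem_toFinset.1 (Finset.mem_filter.1 hf).1)
      _ ≤ ∑ b ∈ (out ω).toFinset, w b := by
          refine Finset.sum_le_sum_of_subset_of_nonneg ?_ ?_
          · intro b hb
            obtain ⟨e, he, rfl⟩ := Finset.mem_image.1 hb
            exact Set.mem_toFinset.2 (hφ e he).1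
          · intro b hb _
            exact hw b ((hind w ω.1 ω.2.1 ω.2.2).subset_ground (Set.mem_toFinset.1 hb))
  rw [finsum_mem_eq_toFinset_sum, mean,
    finsum_eq_sum_of_fintype, mul_div_assoc', le_div_iff₀ (by exact_mod_cast Nat.card_pos)]
  calc (∑ e ∈ I.toFinset, w e) * (Nat.card (A.Seed × Order M × Order M) : ℝ)
      = ∑ e ∈ I.toFinset, w e * (Nat.card (A.Seed × Order M × Order M) : ℝ) := Finset.sum_mul ..
    _ ≤ ∑ e ∈ I.toFinset, w e * (c * (Hit e).ncard) := Finset.sum_le_sum fun e he =>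
        mul_le_mul_of_nonneg_left (h w e (hI.isNonloop_of_mem (Set.mem_toFinset.1 he))) (hwI e he)
    _ = c * ∑ e ∈ I.toFinset, ∑ ω, (if ω ∈ Hit e then w e else 0) := by
        rw [Finset.mul_sum]
        refine Finset.sum_congr rfl fun e _ => ?_
        rw [← Finset.sum_filter, Finset.sum_const, nsmul_eq_mul, Set.ncard_eq_toFinset_card',
          Set.toFinset_ofPred]
        simp only [Hit, Set.mem_ofPred_eq]
        ring
    _ = c * ∑ ω, ∑ e ∈ I.toFinset, (if ω ∈ Hit e then w e else 0) := by rw [Finset.sum_comm]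
    _ ≤ c * ∑ ω, ∑ᶠ e ∈ out ω, w e :=
        mul_le_mul_of_nonneg_left (Finset.sum_le_sum fun ω _ => hpoint ω) hc

/-- Picking one of three bases that cover the ground set is `3`-competitive, since each element
is accepted with probability at least `1 / 3`. -/
theorem coverAlgorithm_isCompetitive [Finite β] {B : Fin 3 → Set β} (hB : ∀ i, M.Indep (B i))
    (hcover : (⋃ i, B i) = M.E) : (coverAlgorithm B).IsCompetitive M 3 := by
  refine OnlineAlgorithm.isCompetitive_of_inParallel (by norm_num) (fun w s π τ => ?_) ?_
  · refine (hB s).subset ?_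
    rintro e ⟨past, future, -, he⟩
    exact he
  · intro w e he
    have hfin : Finite (coverAlgorithm B).Seed := (coverAlgorithm B).finite_seed
    obtain ⟨j, hj⟩ : ∃ j : (coverAlgorithm B).Seed, e ∈ B j :=
      Set.mem_iUnion.1 (hcover.ge he.mem_ground)
    have h1 : (Nat.card (coverAlgorithm B).Seed : ℝ) ≤
        3 * ({j} : Set (coverAlgorithm B).Seed).ncard := by
      rw [Set.ncard_singleton]
      change (Nat.card (Fin 3) : ℝ) ≤ _
      simp
    have h2 : (Nat.card (Order M × Order M) : ℝ) ≤
        1 * (Set.univ : Set (Order M × Order M)).ncard := by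
      rw [Set.ncard_univ, one_mul]
    refine (card_prod_le h1 h2).trans ?_
    rw [mul_one]
    refine mul_le_mul_of_nonneg_left ?_ (by norm_num)
    refine Nat.cast_le.2 (Set.ncard_le_ncard ?_ (Set.toFinite _))
    rintro ⟨s, π, τ⟩ ⟨rfl, -⟩
    refine ⟨e, ?_, he.inParallel_self, le_rfl⟩
    obtain ⟨past, future, h⟩ := List.append_of_mem
      (show e ∈ List.ofFn fun i => (π i : β) from
        List.mem_ofFn.2 ⟨π.symm ⟨e, he.mem_ground⟩, by simp⟩)
    exact ⟨past, future, h, hj⟩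

section Cographic

variable {α : Type*} [Finite α] [Finite β] {G : Graph α β} {R : Component G → Set β}
  {B : Component G → Fin 3 → Set β}

/-- The output has at most one element of each parallel class, and only of classes that meet the
union of the cobases drawn. -/
theorem cographicAlgorithm_output_indep (hR : ∀ C, IsSerialTransversal C.graph (R C))
    (hB : ∀ C, IsCobaseCover (reducedGraph C.graph (R C)) (B C)) (w : β → ℝ)
    (s : (cographicAlgorithm G B).Seed) (π τ : Order G.cographicMatroid) :
    G.cographicMatroid.Indep ((cographicAlgorithm G B).output G.cographicMatroid w s π τ) := by
  have hY : G.cographicMatroid.Indep (⋃ C : Component G, B C (s C)) := by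
    refine Component.cographicMatroid_indep_iUnion fun C => ?_
    have h := ((hB C).1 (s C)).indep
    rw [C.cographicMatroid_reducedGraph (hR C)] at h
    exact h.of_restrict
  have hmem : ∀ e ∈ (cographicAlgorithm G B).output G.cographicMatroid w s π τ,
      ∃ b ∈ ⋃ C : Component G, B C (s C), G.cographicMatroid.InParallel e b := by
    rintro e ⟨past, future, -, C, -, ⟨b, hb, hbB⟩, -⟩
    exact ⟨b, Set.mem_iUnion.2 ⟨C, hbB⟩, hb⟩
  choose! φ hφ using hmem
  refine hY.of_injOn_inParallel φ hφ fun e he e' he' heq => ?_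
  have hp : G.cographicMatroid.InParallel e e' :=
    (hφ e he).2.trans (heq ▸ (hφ e' he').2.symm)
  obtain ⟨past, future, harr, C, -, -, hacc⟩ := he
  obtain ⟨past', future', harr', C', -, -, hacc'⟩ := he'
  rw [← hp.setOf_eq] at hacc'
  exact hacc.eq (fun f hf => hf.2.1.mem_ground) hp.1.inParallel_self hp (harr.symm.trans harr')
    hacc'

/-- If on each parallel class the secretary rule selects the best element with probability at
least `1 / q`, then the algorithm is `3 q`-competitive. -/
theorem cographicAlgorithm_isCompetitive (hR : ∀ C, IsSerialTransversal C.graph (R C))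
    (hB : ∀ C, IsCobaseCover (reducedGraph C.graph (R C)) (B C)) {q : ℝ} (hq0 : 0 ≤ q)
    (hq : ∀ e, G.cographicMatroid.IsNonloop e →
      ∀ k, {f | G.cographicMatroid.InParallel e f}.ncard = k → 0 < k →
      ∀ {P : Set G.cographicMatroid.E} (key : P → ℝ ×ₗ Fin G.cographicMatroid.E.ncard),
        Function.Injective key → (Nat.card (Fin k ≃ P) : ℝ) ≤
          q * {L : Fin k ≃ P | SecretarySuccess key ⌊(k : ℝ) / Real.exp 1⌋₊ L}.ncard) :
    (cographicAlgorithm G B).IsCompetitive G.cographicMatroid (3 * q) := by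
  refine OnlineAlgorithm.isCompetitive_of_inParallel (by positivity)
    (fun w s π τ => cographicAlgorithm_output_indep hR hB w s π τ) ?_
  intro w e he
  have hfin : Finite (cographicAlgorithm G B).Seed := (cographicAlgorithm G B).finite_seed
  have hfinC : Finite (Component G) := inferInstanceAs (Finite (Subtype _))
  obtain ⟨P, hPdef⟩ : ∃ P, {f | G.cographicMatroid.InParallel e f} = P := ⟨_, rfl⟩
  have hP : P ⊆ G.cographicMatroid.E := hPdef ▸ fun f hf => hf.2.1.mem_ground
  obtain ⟨heE, heb⟩ := Graph.cographicMatroid_isNonloop_iff.1 he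
  obtain ⟨C, heC⟩ := Component.exists_mem_edgeSet heE heb
  -- the representative of the class of `e` lies in one of the three cobases
  obtain ⟨f, ⟨hfR, hef⟩, -⟩ := (hR C).2 e heC
  have hef' : G.cographicMatroid.InParallel e f := (C.graph_inParallel_iff.1 hef).1
  obtain ⟨j, hj⟩ : ∃ j, f ∈ B C j := by
    rw [← Set.mem_iUnion, (hB C).2, C.edgeSet_reducedGraph (hR C)]
    exact hfR
  have h1 : (Nat.card (cographicAlgorithm G B).Seed : ℝ) ≤
      3 * {s : (cographicAlgorithm G B).Seed | s C = j}.ncard :=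
    card_le_three_mul_ncard_eval_eq C j
  let Good : Order G.cographicMatroid → Set (Order G.cographicMatroid) := fun τ =>
    {π | ∃ L : Fin P.ncard ≃ P, StrictMono (fun t => π.symm ⟨L t, hP (L t).2⟩) ∧
      SecretarySuccess (fun e : P => weightKey w τ ⟨e, hP e.2⟩)
        ⌊(P.ncard : ℝ) / Real.exp 1⌋₊ L}
  have h2 : ∀ τ, (Nat.card (Order G.cographicMatroid) : ℝ) ≤ q * (Good τ).ncard := by
    intro τ
    let Q : Set G.cographicMatroid.E := {x | (x : β) ∈ P}
    let φ : Q ≃ P :=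
      { toFun := fun x => ⟨x.1.1, x.2⟩
        invFun := fun x => ⟨⟨x.1, hP x.2⟩, x.2⟩
        left_inv := fun _ => rfl
        right_inv := fun _ => rfl }
    have hQ : Nat.card Q = P.ncard := by rw [Nat.card_congr φ, Nat.card_coe_set_eq]
    have hpos : 0 < P.ncard :=
      (Set.ncard_pos (Set.toFinite _)).2 ⟨e, hPdef ▸ he.inParallel_self⟩
    refine (card_le_mul_ncard_restrict hQ _ (hq e he P.ncard (by rw [hPdef]) hpos
      (fun x : Q => weightKey w τ x.1) ((weightKey_injective w τ).comp
        Subtype.val_injective))).trans ?_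
    refine mul_le_mul_of_nonneg_left ?_ hq0
    refine Nat.cast_le.2 (Set.ncard_le_ncard ?_ (Set.toFinite _))
    rintro π ⟨L, hL, hsucc⟩
    exact ⟨L.trans φ, hL, hsucc⟩
  refine (card_prod_le h1 (card_prod_le_of_forall h2)).trans ?_
  refine mul_le_mul_of_nonneg_left ?_ (by positivity)
  refine Nat.cast_le.2 (Set.ncard_le_ncard ?_ (Set.toFinite _))
  rintro ⟨s, π, τ⟩ ⟨hs, L, hL, hsucc⟩
  obtain ⟨b, hbP, hbmax, past, future, harr, hacc⟩ := hsucc.exists_accepts hP rfl hL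
  rw [← hPdef] at hbP
  refine ⟨b, ⟨past, future, harr, C, Component.mem_edgeSet_of_inParallel heC hbP, ?_, ?_⟩, hbP,
    hbmax e (hPdef ▸ he.inParallel_self)⟩
  · exact ⟨f, hbP.symm.trans hef', by rw [hs]; exact hj⟩
  · rw [← hbP.setOf_eq, hPdef]
    exact hacc

end Cographic

end MatroidSecretary

theorem mainTheorem3 {α : Type*} {β : Type*} [Finite α] [Finite β] (G : Graph α β) :
    (∀ C : MatroidSecretary.Component G, ∃ R : Set β,
      MatroidSecretary.IsSerialTransversal C.graph R) ∧
    (∀ R : MatroidSecretary.Component G → Set β,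
      (∀ C, MatroidSecretary.IsSerialTransversal C.graph (R C)) →
      (∀ C, (MatroidSecretary.reducedGraph C.graph (R C)).IsEdgeConnected 3 ∧
        ∃ B : Fin 3 → Set β,
          MatroidSecretary.IsCobaseCover (MatroidSecretary.reducedGraph C.graph (R C)) B) ∧
      ∀ B : MatroidSecretary.Component G → Fin 3 → Set β,
        (∀ C, MatroidSecretary.IsCobaseCover
          (MatroidSecretary.reducedGraph C.graph (R C)) (B C)) →
        (MatroidSecretary.cographicAlgorithm G B).IsCompetitive G.cographicMatroid
          (3 * Real.exp 1) ∧
        (G.IsEdgeConnected 3 →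
          (MatroidSecretary.cographicAlgorithm G B).IsCompetitive G.cographicMatroid 3)) ∧
    (G.IsEdgeConnected 3 →
      (∃ T : Fin 3 → Set β, (∀ i, G.IsSpanningTree (T i)) ∧ (⋃ i, E(G) \ T i) = E(G)) ∧
      ∀ T : Fin 3 → Set β, (∀ i, G.IsSpanningTree (T i)) → (⋃ i, E(G) \ T i) = E(G) →
        (MatroidSecretary.coverAlgorithm fun i => E(G) \ T i).IsCompetitive
          G.cographicMatroid 3) := by
  refine ⟨fun C => C.exists_isSerialTransversal, fun R hR => ⟨fun C => ?_, fun B hB => ⟨?_, ?_⟩⟩,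
    fun hG => ⟨hG.exists_isSpanningTree, fun T hT hcover => ?_⟩⟩
  · have hC := C.isEdgeConnected_reducedGraph (hR C)
    exact ⟨hC, hC.exists_isCobaseCover⟩
  · refine MatroidSecretary.cographicAlgorithm_isCompetitive hR hB (Real.exp_pos 1).le ?_
    intro e _ k _ hk P key hkey
    exact MatroidSecretary.card_le_exp_one_mul_ncard_secretarySuccess hkey hk
  · intro hG
    rw [← mul_one (3 : ℝ)]
    refine MatroidSecretary.cographicAlgorithm_isCompetitive hR hB zero_le_one ?_
    rintro e he k rfl - P key -
    -- each parallel class is a singleton, so the secretary rule accepts its only element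
    have hclass : {f | G.cographicMatroid.InParallel e f} = {e} :=
      Set.eq_singleton_iff_unique_mem.2
        ⟨he.inParallel_self, fun f hf => (hG.eq_of_inParallel hf).symm⟩
    rw [hclass, Set.ncard_singleton, one_mul, ← Set.ncard_univ]
    refine Nat.cast_le.2 (Set.ncard_le_ncard (fun L _ => ?_) (Set.toFinite _))
    refine ⟨0, fun r => (congrArg (fun x => key (L x)) (Subsingleton.elim r 0)).le, ?_,
      fun s hs => (hs.ne (Subsingleton.elim s 0)).elim⟩
    have hfloor : ⌊((1 : ℕ) : ℝ) / Real.exp 1⌋₊ = 0 := by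
      rw [Nat.floor_eq_zero, Nat.cast_one, div_lt_one (Real.exp_pos 1)]
      exact Real.one_lt_exp_iff.2 one_pos
    rw [hfloor]
    exact Nat.zero_le _
  · refine MatroidSecretary.coverAlgorithm_isCompetitive (fun i => ?_) hcover
    exact (((hG.isConnected (by norm_num)).isSpanningTree_iff.1 (hT i)).compl_isBase_dual).indep
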